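/- \textbf{Theorem (Cross-section).} Let $G$ be a compact Lie group with Lie algebra $\mathfrak g$, let $(M,\omega)$ be a symplectic orbifold (Hausdorff, with uniformizing charts $(\tilde U,\Gamma,\varphi)$, $\tilde U\subset\mathbb R^n$ open, $\Gamma$ a finite group acting linearly with fixed point sets of codimension at least two; $\omega$ a closed nondegenerate $2$-form) on which $G$ acts smoothly and symplectically, and let $\Phi\colon M\to\mathfrak g^*$ be a moment map, i.e. a smooth map, equivariant for the coadjoint action, with $\iota(\xi_M)\omega=-d\langle\Phi,\xi\rangle$ for all $\xi\in\mathfrak g$. Let $x\in\mathfrak g^*$, let $G_x$ be its isotropy group for the coadjoint action, with Lie algebra $\mathfrak g_x$, and regard $\mathfrak g_x^*$ as the subspace of $\mathfrak g^*$ that annihilates the $G_x$-invariant complement of $\mathfrak g_x$ in $\mathfrak g$. A \emph{slice} at $x$ is a $G_x$-invariant set $U'\ni x$ such that $G\cdot U'$ is a neighbourhood of $x$ and, for all $y\in U'$, $G\cdot y\cap U'=G_x\cdot y$ and $G_y\subset G_x$. Let $U$ be the \emph{natural slice} at $x$: the union of all connected relatively open subsets of $\mathfrak g_x^*$ that are slices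 at $x$ (for connected $G$ this is the largest such slice). Then $R:=\Phi^{-1}(U)$ is $G_x$-invariant and is a symplectic suborbifold of $M$: the subspace $R$ carries an orbifold structure for which the inclusion $R\hookrightarrow M$ is an embedding of orbifolds (locally it lifts to embeddings of uniformizing charts that are equivariant for isomorphisms of the structure groups), and $\omega$ restricts to a symplectic form $\omega_R$ on $R$. Moreover, $G_x$ acts smoothly and symplectically on $(R,\omega_R)$, and $\Phi|_R$, followed by the restriction $\mathfrak g^*\to\mathfrak g_x^*$, is a moment map for this action. -/

import Mathlib

open Set Filter Topology
open scoped Manifold ContDiff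

noncomputable section

/-- The model space `ℝⁿ`. -/
abbrev Eu (n : ℕ) : Type := EuclideanSpace ℝ (Fin n)

/-! ### Orbifolds -/

/-- A uniformizing chart `(Ũ, Γ, φ)` of dimension `n` on a topological space `X`: an open set
`Ũ ⊆ ℝⁿ`, a finite group `Γ` of linear automorphisms of `ℝⁿ` that preserves `Ũ` and whose nontrivial
elements have fixed point sets of codimension at least two in `Ũ`, and a map `φ : Ũ → X` that
induces a homeomorphism from `Ũ / Γ` onto an open subset of `X` (i.e. `φ` is continuous and open and
its fibres are the `Γ`-orbits). The values of `map` outside `domain` are irrelevant. -/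
structure OrbifoldChart (n : ℕ) (X : Type*) [TopologicalSpace X] where
  domain : Set (Eu n)
  group : Subgroup (Eu n ≃L[ℝ] Eu n)
  map : Eu n → X
  isOpen_domain : IsOpen domain
  finite_group : Finite group
  apply_mem : ∀ γ ∈ group, ∀ u ∈ domain, γ u ∈ domain
  codim_fixed : ∀ γ ∈ group, γ ≠ 1 → (∃ u ∈ domain, γ u = u) →
    Module.finrank ℝ (LinearMap.ker ((γ : Eu n →L[ℝ] Eu n).toLinearMap - LinearMap.id)) + 2 ≤ n
  continuousOn_map : ContinuousOn map domain
  isOpen_image : ∀ V ⊆ domain, IsOpen V → IsOpen (map '' V)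
  map_eq_iff : ∀ u ∈ domain, ∀ v ∈ domain, map u = map v ↔ ∃ γ ∈ group, γ u = v

/-- The isotropy group `Γ_u` of a point `u` of the domain of a uniformizing chart. -/
def OrbifoldChart.isotropy {n : ℕ} {X : Type*} [TopologicalSpace X] (c : OrbifoldChart n X)
    (u : Eu n) : Subgroup (Eu n ≃L[ℝ] Eu n) where
  carrier := {γ | γ ∈ c.group ∧ γ u = u}
  mul_mem' := by
    rintro a b ⟨ha, ha'⟩ ⟨hb, hb'⟩
    exact ⟨c.group.mul_mem ha hb, by
      change a (b u) = u
      rw [hb', ha']⟩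
  one_mem' := ⟨c.group.one_mem, rfl⟩
  inv_mem' := by
    rintro a ⟨ha, ha'⟩
    exact ⟨c.group.inv_mem ha, by
      change a.symm u = u
      rw [ContinuousLinearEquiv.symm_apply_eq, ha']⟩

/-- A transition between two uniformizing charts: a diffeomorphism `h` between open subsets of
their domains that covers the identity of `X`. -/
structure IsTransition {n : ℕ} {X : Type*} [TopologicalSpace X] (c d : OrbifoldChart n X)
    (h : OpenPartialHomeomorph (Eu n) (Eu n)) : Prop where
  source_subset : h.source ⊆ c.domain
  target_subset : h.target ⊆ d.domain
  contDiffOn : ContDiffOn ℝ ∞ h h.source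
  contDiffOn_symm : ContDiffOn ℝ ∞ h.symm h.target
  map_eq : ∀ u ∈ h.source, d.map (h u) = c.map u

/-- An `n`-dimensional orbifold structure on a topological space `X`: an atlas of uniformizing
charts that cover `X` and are compatible: two points over the same point of `X` are always related
by a transition. -/
structure Orbifold (n : ℕ) (X : Type*) [TopologicalSpace X] where
  atlas : Set (OrbifoldChart n X)
  cover : ∀ p : X, ∃ c ∈ atlas, ∃ u ∈ c.domain, c.map u = p
  compatible : ∀ c ∈ atlas, ∀ d ∈ atlas, ∀ u ∈ c.domain, ∀ v ∈ d.domain, c.map u = d.map v →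
    ∃ h : OpenPartialHomeomorph (Eu n) (Eu n), IsTransition c d h ∧ u ∈ h.source ∧ h u = v

namespace Orbifold

/-- A (smooth) differential `p`-form on an orbifold: a smooth `p`-form on the domain of each chart
of the atlas, such that all transitions pull these forms back to one another. Since the elements of
the group of a chart restrict to transitions from the chart to itself, the forms are invariant. -/
structure Form {n : ℕ} {X : Type*} [TopologicalSpace X] (M : Orbifold n X) (p : ℕ) where
  form : OrbifoldChart n X → Eu n → (Eu n) [⋀^Fin p]→L[ℝ] ℝ
  contDiffOn : ∀ c ∈ M.atlas, ContDiffOn ℝ ∞ (form c) c.domain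
  pullback : ∀ c ∈ M.atlas, ∀ d ∈ M.atlas, ∀ h : OpenPartialHomeomorph (Eu n) (Eu n),
    IsTransition c d h → ∀ u ∈ h.source,
      form c u = (form d (h u)).compContinuousLinearMap (fderiv ℝ h u)

/-- A symplectic form: a closed and nondegenerate `2`-form. -/
structure IsSymplectic {n : ℕ} {X : Type*} [TopologicalSpace X] (M : Orbifold n X)
    (σ : M.Form 2) : Prop where
  closed : ∀ c ∈ M.atlas, ∀ u ∈ c.domain, extDeriv (σ.form c) u = 0
  nondegenerate : ∀ c ∈ M.atlas, ∀ u ∈ c.domain, ∀ v : Eu n,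
    (∀ w : Eu n, σ.form c u ![v, w] = 0) → v = 0

/-- A map `f : Y → X` is an embedding of the orbifold `N` on `Y` into the orbifold `M` on `X`: it is
a topological embedding, and around each point it lifts to an embedding `j` of open subsets of
uniformizing charts, onto the full preimage of `f(Y)` near the image point, that intertwines the
structure groups of the two points by an isomorphism.

When `Y` is a subspace of `X` and `f` is the inclusion, this says that `Y`, with the orbifold
structure `N`, is a suborbifold of `M`. -/
structure IsEmbedding {k n : ℕ} {Y X : Type*} [TopologicalSpace Y] [TopologicalSpace X]
    (N : Orbifold k Y) (M : Orbifold n X) (f : Y → X) : Prop where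
  isEmbedding : Topology.IsEmbedding f
  exists_lift : ∀ c ∈ N.atlas, ∀ d ∈ M.atlas, ∀ u ∈ c.domain, ∀ v ∈ d.domain,
    d.map v = f (c.map u) →
    ∃ (W : Set (Eu k)) (O : Set (Eu n)) (j : Eu k → Eu n),
      IsOpen W ∧ u ∈ W ∧ W ⊆ c.domain ∧ IsOpen O ∧ v ∈ O ∧ O ⊆ d.domain ∧
      ContDiffOn ℝ ∞ j W ∧ (∀ w ∈ W, Function.Injective (fderiv ℝ j w)) ∧
      Topology.IsEmbedding (W.domRestrict j) ∧
      j u = v ∧ (∀ w ∈ W, d.map (j w) = f (c.map w)) ∧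
      j '' W = O ∩ d.map ⁻¹' range f ∧
      ∃ θ : c.isotropy u ≃* d.isotropy v,
        ∀ γ : c.isotropy u, ∀ᶠ w in 𝓝 u,
          j ((γ : Eu k ≃L[ℝ] Eu k) w) = (θ γ : Eu n ≃L[ℝ] Eu n) (j w)

/-- The form `η` on `N` is the pullback of the form `σ` on `M` along `f`: in uniformizing charts it
is the pullback along every smooth lift of `f`. -/
def Form.IsPullback {k n p : ℕ} {Y X : Type*} [TopologicalSpace Y] [TopologicalSpace X]
    {N : Orbifold k Y} {M : Orbifold n X} (η : N.Form p) (f : Y → X) (σ : M.Form p) : Prop :=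
  ∀ c ∈ N.atlas, ∀ d ∈ M.atlas, ∀ (W : Set (Eu k)) (j : Eu k → Eu n),
    IsOpen W → W ⊆ c.domain → ContDiffOn ℝ ∞ j W →
    (∀ w ∈ W, j w ∈ d.domain ∧ d.map (j w) = f (c.map w)) →
    ∀ w ∈ W, η.form c w = (σ.form d (j w)).compContinuousLinearMap (fderiv ℝ j w)

end Orbifold

/-! ### The coadjoint action, and Lie algebras of closed subgroups -/

section LieGroup

variable {E : Type*} [NormedAddCommGroup E] [NormedSpace ℝ E]
  {H : Type*} [TopologicalSpace H] (I : ModelWithCorners ℝ E H)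
  {G : Type*} [TopologicalSpace G] [ChartedSpace H G] [Group G]

set_option linter.unusedSectionVars false

/-- The velocity at time `0` of a curve in `G`. -/
def velocity (c : ℝ → G) : E := mfderiv 𝓘(ℝ, ℝ) I c 0 (1 : ℝ)

/-- The adjoint action of `g`: the derivative at the identity of conjugation by `g`. -/
def Ad (g : G) : GroupLieAlgebra I G →L[ℝ] GroupLieAlgebra I G :=
  mfderiv I I (fun h : G => g * h * g⁻¹) 1

/-- The dual `𝔤*` of the Lie algebra. -/
abbrev LieDual (G : Type*) [TopologicalSpace G] [ChartedSpace H G] [Group G] : Type _ :=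
  GroupLieAlgebra I G →L[ℝ] ℝ

/-- The coadjoint action: `⟨Ad*(g) y, ξ⟩ = ⟨y, Ad(g⁻¹) ξ⟩`. -/
def coad (g : G) (y : LieDual I G) : LieDual I G := y.comp (Ad I g⁻¹)

theorem Ad_one : Ad I (1 : G) = ContinuousLinearMap.id ℝ (GroupLieAlgebra I G) := by
  have h : (fun h : G => (1 : G) * h * (1 : G)⁻¹) = id := by
    ext x
    simp
  unfold Ad
  rw [h]
  exact mfderiv_id

theorem coad_one (y : LieDual I G) : coad I (1 : G) y = y := by
  unfold coad
  rw [inv_one, Ad_one]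
  rfl

variable [LieGroup I ∞ G]

theorem Ad_mul (g h : G) : Ad I (g * h) = (Ad I g).comp (Ad I h) := by
  have key : ∀ g : G, MDifferentiable I I (fun k : G => g * k * g⁻¹) := fun g =>
    ((contMDiff_const.mul contMDiff_id).mul contMDiff_const : ContMDiff I I ∞
      (fun k : G => g * k * g⁻¹)).mdifferentiable (by simp)
  have e : (fun k : G => g * h * k * (g * h)⁻¹) =
      (fun k : G => g * k * g⁻¹) ∘ (fun k : G => h * k * h⁻¹) := by
    ext k
    simp [mul_assoc]
  have h1 : h * 1 * h⁻¹ = (1 : G) := by simp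
  have := mfderiv_comp (I := I) (I' := I) (I'' := I) (1 : G) (key g (h * 1 * h⁻¹)) (key h 1)
  unfold Ad
  rw [e]
  refine this.trans ?_
  have aux : ∀ q : G, q = 1 → (mfderiv I I (fun k : G => g * k * g⁻¹) q : E →L[ℝ] E) =
      (mfderiv I I (fun k : G => g * k * g⁻¹) 1 : E →L[ℝ] E) := by
    rintro q rfl
    rfl
  exact congrArg (fun L : E →L[ℝ] E => L.comp (mfderiv I I (fun k : G => h * k * h⁻¹) 1 : E →L[ℝ] E))
    (aux _ h1)

theorem coad_mul (g h : G) (y : LieDual I G) : coad I (g * h) y = coad I g (coad I h y) := by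
  unfold coad
  rw [mul_inv_rev, Ad_mul]
  rfl

/-- The isotropy group `G_x` of `x ∈ 𝔤*` for the coadjoint action. -/
def coadStabilizer (x : LieDual I G) : Subgroup G where
  carrier := {g | coad I g x = x}
  mul_mem' := by
    intro a b (ha : coad I a x = x) (hb : coad I b x = x)
    change coad I (a * b) x = x
    rw [coad_mul, hb, ha]
  one_mem' := coad_one I x
  inv_mem' := by
    intro a (ha : coad I a x = x)
    change coad I a⁻¹ x = x
    calc coad I a⁻¹ x = coad I a⁻¹ (coad I a x) := by rw [ha]
      _ = x := by rw [← coad_mul, inv_mul_cancel, coad_one]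

theorem mfderiv_curve_mul {c e : ℝ → G} (hc : c 0 = 1) (he : e 0 = 1)
    (hcd : MDifferentiableAt 𝓘(ℝ, ℝ) I c 0) (hed : MDifferentiableAt 𝓘(ℝ, ℝ) I e 0) :
    MDifferentiableAt 𝓘(ℝ, ℝ) I (fun t => c t * e t) 0 ∧
      velocity I (fun t => c t * e t) = velocity I c + velocity I e := by
  have hm : MDifferentiable (I.prod I) I (fun p : G × G => p.1 * p.2) :=
    (contMDiff_mul I ∞).mdifferentiable (by simp)
  have hp : MDifferentiableAt 𝓘(ℝ, ℝ) (I.prod I) (fun t => (c t, e t)) 0 := hcd.prodMk hed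
  refine ⟨(hm (c 0, e 0)).comp (0 : ℝ) hp, ?_⟩
  have h1 : mfderiv 𝓘(ℝ, ℝ) I (fun t => c t * e t) 0 (1 : ℝ) =
      mfderiv (I.prod I) I (fun p : G × G => p.1 * p.2) (c 0, e 0)
        (mfderiv 𝓘(ℝ, ℝ) (I.prod I) (fun t => (c t, e t)) 0 (1 : ℝ)) :=
    mfderiv_comp_apply (I' := I.prod I) (0 : ℝ) (hm (c 0, e 0)) hp (1 : ℝ)
  have h2 : mfderiv 𝓘(ℝ, ℝ) (I.prod I) (fun t => (c t, e t)) 0 (1 : ℝ) =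
      ((mfderiv 𝓘(ℝ, ℝ) I c 0 (1 : ℝ) : E), (mfderiv 𝓘(ℝ, ℝ) I e 0 (1 : ℝ) : E)) := by
    rw [mfderiv_prodMk hcd hed]
    rfl
  have h3 := mfderiv_prod_eq_add_apply (I := I) (I' := I) (I'' := I)
    (v := mfderiv 𝓘(ℝ, ℝ) (I.prod I) (fun t => (c t, e t)) 0 (1 : ℝ)) (hm (c 0, e 0))
  have aux : ∀ f : G → G, f = id → ∀ (q : G) (v : E), (mfderiv I I f q v : E) = v := by
    rintro f rfl q v
    rw [mfderiv_id]
    rfl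
  refine (h1.trans h3).trans ?_
  rw [h2]
  exact congrArg₂ (fun a b : E => a + b)
    (aux (fun z : G => z * e 0) (by ext z; simp [he]) _ _)
    (aux (fun z : G => c 0 * z) (by ext z; simp [hc]) _ _)

theorem mfderiv_curve_smul {c : ℝ → G} (a : ℝ) (hcd : MDifferentiableAt 𝓘(ℝ, ℝ) I c 0) :
    MDifferentiableAt 𝓘(ℝ, ℝ) I (fun t => c (a * t)) 0 ∧
      velocity I (fun t => c (a * t)) = a • velocity I c := by
  have hd : HasFDerivAt (fun t : ℝ => a * t) (a • ContinuousLinearMap.id ℝ ℝ) 0 :=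
    (hasFDerivAt_id (0 : ℝ)).const_mul a
  have hd' : HasMFDerivAt 𝓘(ℝ, ℝ) 𝓘(ℝ, ℝ) (fun t : ℝ => a * t) 0
      (a • ContinuousLinearMap.id ℝ ℝ) := hd.hasMFDerivAt
  have aux : ∀ q : ℝ, q = 0 → HasMFDerivAt 𝓘(ℝ, ℝ) I c q (mfderiv 𝓘(ℝ, ℝ) I c 0 : ℝ →L[ℝ] E) := by
    rintro q rfl
    exact hcd.hasMFDerivAt
  have := HasMFDerivAt.comp (0 : ℝ) (aux (a * 0) (by simp)) hd'
  refine ⟨this.mdifferentiableAt, ?_⟩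
  have h := this.mfderiv
  refine (congrArg (fun L : ℝ →L[ℝ] E => L 1) h).trans ?_
  change (mfderiv 𝓘(ℝ, ℝ) I c 0 : ℝ →L[ℝ] E) (a • (1 : ℝ)) = _
  exact map_smul (mfderiv 𝓘(ℝ, ℝ) I c 0 : ℝ →L[ℝ] E) a (1 : ℝ)

/-- The Lie algebra of a closed subgroup `K` of `G`, as a subspace of `𝔤`: the velocities at the
identity of the curves in `G` that lie in `K`, pass through the identity at time `0` and are
differentiable there. For `K = ⊤` this is all of `𝔤`. -/
def lieAlgebraOf (K : Subgroup G) : Submodule ℝ (GroupLieAlgebra I G) where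
  carrier := {ξ | ∃ c : ℝ → G, c 0 = 1 ∧ (∀ t, c t ∈ K) ∧
    MDifferentiableAt 𝓘(ℝ, ℝ) I c 0 ∧ velocity I c = ξ}
  zero_mem' := ⟨fun _ => 1, rfl, fun _ => K.one_mem, mdifferentiableAt_const, 
    congrArg (fun L : ℝ →L[ℝ] E => L 1) (mfderiv_const (I := 𝓘(ℝ, ℝ)) (I' := I) (c := (1 : G)))⟩
  add_mem' := by
    rintro ξ η ⟨c, hc, hcK, hcd, hξ⟩ ⟨e, he, heK, hed, hη⟩
    obtain ⟨h1, h2⟩ := mfderiv_curve_mul I hc he hcd hed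
    refine ⟨fun t => c t * e t, by simp only [hc, he, mul_one], fun t => K.mul_mem (hcK t) (heK t), h1, ?_⟩
    exact h2.trans (congrArg₂ (fun a b : E => a + b) hξ hη)
  smul_mem' := by
    rintro a ξ ⟨c, hc, hcK, hcd, hξ⟩
    obtain ⟨h1, h2⟩ := mfderiv_curve_smul I a hcd
    refine ⟨fun t => c (a * t), by simp [hc], fun t => hcK _, h1, ?_⟩
    exact h2.trans (congrArg (fun v : E => a • v) hξ)

/-- `m` is a `G_x`-invariant complement of `𝔤_x` in `𝔤`. (For compact `G` it exists and is
unique.) -/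
def IsInvariantComplement (x : LieDual I G) (m : Submodule ℝ (GroupLieAlgebra I G)) : Prop :=
  IsCompl (lieAlgebraOf I (coadStabilizer I x)) m ∧
    ∀ g ∈ coadStabilizer I x, ∀ ξ ∈ m, Ad I g ξ ∈ m

/-- The subspace `𝔤_x* ⊆ 𝔤*`: the annihilator of the `G_x`-invariant complement of `𝔤_x`. -/
def isotropyDual (x : LieDual I G) : Set (LieDual I G) :=
  {y | ∃ m, IsInvariantComplement I x m ∧ ∀ ξ ∈ m, y ξ = 0}

/-- `U ⊆ 𝔤*` is a slice at `x` for the coadjoint action: it contains `x` and is `G_x`-invariant,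
`G · U` is a neighbourhood of `x`, and `G · y ∩ U = G_x · y` and `G_y ⊆ G_x` for all `y ∈ U`. -/
structure IsCoadSlice (x : LieDual I G) (U : Set (LieDual I G)) : Prop where
  mem : x ∈ U
  invariant : ∀ g ∈ coadStabilizer I x, ∀ y ∈ U, coad I g y ∈ U
  saturation_mem_nhds : {z | ∃ g : G, ∃ y ∈ U, z = coad I g y} ∈ 𝓝 x
  orbit_inter : ∀ y ∈ U, ∀ g : G, coad I g y ∈ U →
    ∃ h ∈ coadStabilizer I x, coad I g y = coad I h y
  stabilizer_le : ∀ y ∈ U, coadStabilizer I y ≤ coadStabilizer I x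

/-- The natural slice at `x` for the coadjoint action: the largest connected open subset of `𝔤_x*`
that is a slice at `x`, i.e. the union of all of these. -/
def naturalSlice (x : LieDual I G) : Set (LieDual I G) :=
  ⋃₀ {U | (∃ V, IsOpen V ∧ U = V ∩ isotropyDual I x) ∧ IsConnected U ∧ IsCoadSlice I x U}

end LieGroup

/-! ### Actions on orbifolds and moment maps

The notions below are given for the action of a closed subgroup `K` of a Lie group `G`; the case of
`G` itself is `K = ⊤`. A map on (an open part of) `K × ℝⁿ` is smooth if it is locally the
restriction of a smooth map on an open part of `G × ℝⁿ`. -/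

section Action

variable {E : Type*} [NormedAddCommGroup E] [NormedSpace ℝ E]
  {H : Type*} [TopologicalSpace H] (I : ModelWithCorners ℝ E H)
  {G : Type*} [TopologicalSpace G] [ChartedSpace H G] [Group G] (K : Subgroup G)
  {n : ℕ} {X : Type*} [TopologicalSpace X] [MulAction K X]

/-- A smooth local lift of the action map `K × X → X` to uniformizing charts `c` and `d`:
a smooth map `a` on an open set `O ⊆ G × Ũ_c` with values in `Ũ_d` that covers `(k, p) ↦ k • p`
at all points whose first component lies in `K`. -/
structure IsActionLift (c d : OrbifoldChart n X) (O : Set (G × Eu n)) (a : G × Eu n → Eu n) :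
    Prop where
  isOpen : IsOpen O
  mem_domain : ∀ q ∈ O, q.2 ∈ c.domain
  apply_mem : ∀ q ∈ O, a q ∈ d.domain
  contMDiffOn : ContMDiffOn (I.prod 𝓘(ℝ, Eu n)) 𝓘(ℝ, Eu n) ∞ a O
  map_eq : ∀ (k : K) (u : Eu n), ((k : G), u) ∈ O → d.map (a (k, u)) = k • c.map u

namespace Orbifold

/-- The action of `K` on the orbifold `M` is smooth: the action map has smooth local lifts. -/
def IsSmoothAction (M : Orbifold n X) : Prop :=
  ∀ c ∈ M.atlas, ∀ d ∈ M.atlas, ∀ (k : K), ∀ u ∈ c.domain, ∀ v ∈ d.domain,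
    d.map v = k • c.map u →
    ∃ (O : Set (G × Eu n)) (a : G × Eu n → Eu n),
      IsActionLift I K c d O a ∧ ((k : G), u) ∈ O ∧ a (k, u) = v

/-- The action of `K` preserves the form `σ`. -/
def PreservesForm (M : Orbifold n X) {p : ℕ} (σ : M.Form p) : Prop :=
  ∀ c ∈ M.atlas, ∀ d ∈ M.atlas, ∀ (O : Set (G × Eu n)) (a : G × Eu n → Eu n),
    IsActionLift I K c d O a → ∀ (k : K) (u : Eu n), ((k : G), u) ∈ O →
      σ.form c u =
        (σ.form d (a (k, u))).compContinuousLinearMap (fderiv ℝ (fun w => a (k, w)) u)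

/-- The vector `ξ_M(u)` that `ξ ∈ 𝔤` induces at a point `u` of a uniformizing chart, computed with
a local lift `a` of the action near the identity: the derivative at the identity of `g ↦ a(g, u)`
in the direction `ξ`. -/
def inducedVector (a : G × Eu n → Eu n) (ξ : GroupLieAlgebra I G) (u : Eu n) : Eu n :=
  mfderiv I 𝓘(ℝ, Eu n) (fun g => a (g, u)) 1 ξ

variable [LieGroup I ∞ G]

/-- `Φ : X → 𝔤*`, followed by the restriction `𝔤* → 𝔨*`, is a moment map for the action of `K`: it
is smooth, it is equivariant for the coadjoint action of `K` on `𝔨*`, and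
`ι(ξ_M) σ = - d⟨Φ, ξ⟩` for all `ξ ∈ 𝔨`. -/
structure IsMomentMap (M : Orbifold n X) (σ : M.Form 2) (Φ : X → LieDual I G) : Prop where
  contDiffOn : ∀ c ∈ M.atlas, ∀ ξ ∈ lieAlgebraOf I K,
    ContDiffOn ℝ ∞ (fun u => Φ (c.map u) ξ) c.domain
  equivariant : ∀ (k : K) (p : X), ∀ ξ ∈ lieAlgebraOf I K,
    Φ (k • p) ξ = coad I (k : G) (Φ p) ξ
  contraction_eq : ∀ c ∈ M.atlas, ∀ (O : Set (G × Eu n)) (a : G × Eu n → Eu n),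
    IsActionLift I K c c O a → (∀ u, ((1 : G), u) ∈ O → a (1, u) = u) →
    ∀ u, ((1 : G), u) ∈ O → ∀ ξ ∈ lieAlgebraOf I K, ∀ w : Eu n,
      σ.form c u ![inducedVector I a ξ u, w] = - fderiv ℝ (fun u' => Φ (c.map u') ξ) u w

end Orbifold

end Action

end

noncomputable section

/-! ### Smoothness of pullbacks of alternating maps -/

section Calculus

variable {V W F : Type*} [NormedAddCommGroup V] [NormedSpace ℝ V] [NormedAddCommGroup W]
  [NormedSpace ℝ W] [NormedAddCommGroup F] [NormedSpace ℝ F]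

theorem exists_clm_leftInverse_alternating {k p : ℕ} :
    ∃ L : ((Fin p → Fin k) → ℝ) →L[ℝ] ((Eu k) [⋀^Fin p]→L[ℝ] ℝ), ∀ A : (Eu k) [⋀^Fin p]→L[ℝ] ℝ,
      L (fun s => A fun i => EuclideanSpace.basisFun (Fin k) ℝ (s i)) = A := by
  let ev : ((Eu k) [⋀^Fin p]→L[ℝ] ℝ) →ₗ[ℝ] ((Fin p → Fin k) → ℝ) :=
    { toFun := fun A s => A fun i => EuclideanSpace.basisFun (Fin k) ℝ (s i)
      map_add' := fun A B => by ext s; simp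
      map_smul' := fun a A => by ext s; simp }
  have hinj : LinearMap.ker ev = ⊥ := by
    rw [LinearMap.ker_eq_bot]
    intro A B hAB
    apply ContinuousAlternatingMap.toAlternatingMap_injective
    refine Module.Basis.ext_alternating (EuclideanSpace.basisFun (Fin k) ℝ).toBasis ?_
    intro s _
    have := congrFun hAB s
    simpa [ev] using this
  obtain ⟨l, hl⟩ := LinearMap.exists_leftInverse_of_injective ev hinj
  refine ⟨LinearMap.toContinuousLinearMap l, fun A => ?_⟩
  exact LinearMap.congr_fun hl A

theorem contDiffOn_compContinuousLinearMap {k p : ℕ} {r : WithTop ℕ∞} {s : Set F}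
    {A : F → W [⋀^Fin p]→L[ℝ] ℝ} {B : F → Eu k →L[ℝ] W}
    (hA : ContDiffOn ℝ r A s) (hB : ContDiffOn ℝ r B s) :
    ContDiffOn ℝ r (fun w => (A w).compContinuousLinearMap (B w)) s := by
  obtain ⟨L, hL⟩ := exists_clm_leftInverse_alternating (k := k) (p := p)
  have key : ContDiffOn ℝ r (fun w => L fun t => (A w).compContinuousLinearMap (B w)
      fun i => EuclideanSpace.basisFun (Fin k) ℝ (t i)) s := by
    refine L.contDiff.comp_contDiffOn (contDiffOn_pi.2 fun t => ?_)
    have h1 : ContDiffOn ℝ r (fun w =>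
        ContinuousMultilinearMap.compContinuousLinearMapContinuousMultilinear ℝ
          (fun _ : Fin p => Eu k) (fun _ : Fin p => W) ℝ (fun _ => B w)
          (ContinuousAlternatingMap.toContinuousMultilinearMapCLM ℝ (A w))) s := by
      refine ContDiffOn.clm_apply ?_ ?_
      · exact (ContinuousMultilinearMap.contDiff _).comp_contDiffOn (contDiffOn_pi.2 fun _ => hB)
      · exact (ContinuousAlternatingMap.toContinuousMultilinearMapCLM ℝ).contDiff.comp_contDiffOn hA
    exact (ContinuousMultilinearMap.apply ℝ (fun _ : Fin p => Eu k) ℝ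
      (fun i => EuclideanSpace.basisFun (Fin k) ℝ (t i))).contDiff.comp_contDiffOn h1
  simpa only [hL] using key

theorem ContDiffOn.pullback_form {k p : ℕ} {s : Set (Eu k)} (hs : IsOpen s) {t : Set W}
    {A : W → W [⋀^Fin p]→L[ℝ] ℝ} {f : Eu k → W}
    (hA : ContDiffOn ℝ ∞ A t) (hf : ContDiffOn ℝ ∞ f s) (hst : MapsTo f s t) :
    ContDiffOn ℝ ∞ (fun w => (A (f w)).compContinuousLinearMap (fderiv ℝ f w)) s :=
  contDiffOn_compContinuousLinearMap (hA.comp hf hst)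
    (hf.fderiv_of_isOpen hs (by simp))

end Calculus

/-! ### Lifts to uniformizing charts -/

theorem exists_open_subset_of_finite_cover {Z ι : Type*} [TopologicalSpace Z] {C : ι → Set Z}
    {S : Set ι} (hS : S.Finite) : ∀ W : Set Z, IsOpen W → W.Nonempty →
    (∀ i ∈ S, ∀ W' ⊆ W, IsOpen W' → IsOpen (W' \ C i)) → (W ⊆ ⋃ i ∈ S, C i) →
    ∃ i ∈ S, ∃ W' ⊆ W, IsOpen W' ∧ W'.Nonempty ∧ W' ⊆ C i := by
  induction S, hS using Set.Finite.induction_on with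
  | empty =>
    intro W _ hne _ hc
    obtain ⟨w, hw⟩ := hne
    simpa using hc hw
  | @insert a s _ _ ih =>
    intro W hW hne ho hc
    by_cases h : (W \ C a).Nonempty
    · obtain ⟨i, hi, W', hW', h1⟩ := ih (W \ C a) (ho a (mem_insert _ _) W subset_rfl hW) h
        (fun i hi W' hW' => ho i (mem_insert_of_mem _ hi) W' (hW'.trans sdiff_subset))
        (fun w hw => by
          have := hc hw.1
          simp only [mem_insert_iff, iUnion_iUnion_eq_or_left, mem_union] at this
          exact this.resolve_left hw.2)
      exact ⟨i, mem_insert_of_mem _ hi, W', hW'.trans sdiff_subset, h1⟩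
    · refine ⟨a, mem_insert _ _, W, subset_rfl, hW, hne, fun w hw => ?_⟩
      by_contra hwa
      exact h ⟨w, hw, hwa⟩

section Lifts

variable {n : ℕ} {X : Type*} [TopologicalSpace X]

theorem OrbifoldChart.exists_eqOn_of_map_eq (d : OrbifoldChart n X) {Z : Type*}
    [TopologicalSpace Z] {W : Set Z} (hW : IsOpen W) (hne : W.Nonempty) {f g : Z → Eu n}
    (hf : ContinuousOn f W) (hg : ContinuousOn g W) (hfd : MapsTo f W d.domain)
    (hgd : MapsTo g W d.domain) (h : ∀ w ∈ W, d.map (f w) = d.map (g w)) :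
    ∃ γ ∈ d.group, ∃ W' ⊆ W, IsOpen W' ∧ W'.Nonempty ∧ ∀ w ∈ W', γ (f w) = g w := by
  refine exists_open_subset_of_finite_cover (C := fun γ : Eu n ≃L[ℝ] Eu n => {w | γ (f w) = g w})
    (S := (d.group : Set (Eu n ≃L[ℝ] Eu n))) ?_ W hW hne ?_ ?_
  · have := d.finite_group
    exact Set.toFinite _
  · intro γ _ W' hW' ho
    have := ((γ.continuous.comp_continuousOn (hf.mono hW')).prodMk
      (hg.mono hW')).isOpen_inter_preimage ho isClosed_diagonal.isOpen_compl
    convert this using 1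
    ext w
    rfl
  · intro w hw
    obtain ⟨γ, hγ, e⟩ := (d.map_eq_iff _ (hfd hw) _ (hgd hw)).1 (h w hw)
    exact mem_iUnion₂.2 ⟨γ, hγ, e⟩

theorem isTransition_of_mem_group (d : OrbifoldChart n X) {γ : Eu n ≃L[ℝ] Eu n}
    (hγ : γ ∈ d.group) :
    IsTransition d d ((γ.toHomeomorph.toOpenPartialHomeomorph).restrOpen d.domain
      d.isOpen_domain) where
  source_subset := by simp
  target_subset := by
    intro v hv
    simp only [OpenPartialHomeomorph.restrOpen_toPartialEquiv, PartialEquiv.restr_target,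
      mem_inter_iff, mem_preimage] at hv
    have := d.apply_mem γ hγ _ hv.2
    simpa using this
  contDiffOn := γ.contDiff.contDiffOn
  contDiffOn_symm := γ.symm.contDiff.contDiffOn
  map_eq := by
    intro u hu
    have hu' : u ∈ d.domain := by simpa using hu
    exact ((d.map_eq_iff u hu' _ (d.apply_mem γ hγ u hu')).2 ⟨γ, hγ, rfl⟩).symm

theorem OrbifoldChart.map_apply (d : OrbifoldChart n X) {γ : Eu n ≃L[ℝ] Eu n}
    (hγ : γ ∈ d.group) {u : Eu n} (hu : u ∈ d.domain) : d.map (γ u) = d.map u :=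
  ((d.map_eq_iff u hu _ (d.apply_mem γ hγ u hu)).2 ⟨γ, hγ, rfl⟩).symm

theorem Orbifold.Form.invariant {M : Orbifold n X} {p : ℕ} (σ : M.Form p) {d : OrbifoldChart n X}
    (hd : d ∈ M.atlas) {γ : Eu n ≃L[ℝ] Eu n} (hγ : γ ∈ d.group) {u : Eu n} (hu : u ∈ d.domain) :
    σ.form d u = (σ.form d (γ u)).compContinuousLinearMap (γ : Eu n →L[ℝ] Eu n) := by
  have := σ.pullback d hd d hd _ (isTransition_of_mem_group d hγ) u (by simpa using hu)
  refine this.trans ?_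
  have h1 : fderiv ℝ (fun x => γ x) u = (γ : Eu n →L[ℝ] Eu n) := γ.fderiv
  exact congrArg (fun L => (σ.form d (γ u)).compContinuousLinearMap L) h1

theorem Orbifold.Form.pullback_eq_of_map_eq {M : Orbifold n X} {p k : ℕ} (σ : M.Form p)
    {d : OrbifoldChart n X} (hd : d ∈ M.atlas) {W : Set (Eu k)} (hW : IsOpen W) {f g : Eu k → Eu n}
    (hf : ContDiffOn ℝ ∞ f W) (hg : ContDiffOn ℝ ∞ g W) (hfd : MapsTo f W d.domain)
    (hgd : MapsTo g W d.domain) (h : ∀ w ∈ W, d.map (f w) = d.map (g w)) {w : Eu k} (hw : w ∈ W) :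
    (σ.form d (f w)).compContinuousLinearMap (fderiv ℝ f w) =
      (σ.form d (g w)).compContinuousLinearMap (fderiv ℝ g w) := by
  have hP := ((σ.contDiffOn d hd).pullback_form hW hf hfd).continuousOn
  have hQ := ((σ.contDiffOn d hd).pullback_form hW hg hgd).continuousOn
  by_contra hne
  have ho := (hP.prodMk hQ).isOpen_inter_preimage hW isClosed_diagonal.isOpen_compl
  obtain ⟨γ, hγ, W', hW', ho', ⟨v, hv⟩, e⟩ := d.exists_eqOn_of_map_eq ho ⟨w, hw, hne⟩
    (hf.continuousOn.mono inter_subset_left) (hg.continuousOn.mono inter_subset_left)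
    (hfd.mono_left inter_subset_left) (hgd.mono_left inter_subset_left) (fun w hw => h w hw.1)
  have hvW := (hW' hv).1
  refine (hW' hv).2 ?_
  have hg' : g =ᶠ[𝓝 v] fun w => γ (f w) :=
    Filter.eventuallyEq_of_mem (ho'.mem_nhds hv) fun w hw => (e w hw).symm
  have hfv : DifferentiableAt ℝ f v :=
    (hf.contDiffAt (hW.mem_nhds hvW)).differentiableAt (by simp)
  have hd1 : fderiv ℝ g v = (γ : Eu n →L[ℝ] Eu n).comp (fderiv ℝ f v) := by
    rw [hg'.fderiv_eq]
    exact γ.comp_fderiv (f := f) (x := v)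
  change _ = _
  dsimp only
  rw [hd1, ← e v hv, σ.invariant hd hγ (hfd hvW)]
  rfl

/-- A smooth local lift of the identity map is given by an element of the structure group. -/
theorem OrbifoldChart.exists_eventuallyEq_of_map_eq (d : OrbifoldChart n X) {h : Eu n → Eu n}
    {u : Eu n} {W : Set (Eu n)} (hW : IsOpen W) (hu : u ∈ W) (hWd : W ⊆ d.domain)
    (hh : ContDiffOn ℝ 1 h W) (hhd : MapsTo h W d.domain)
    (hmap : ∀ w ∈ W, d.map (h w) = d.map w) :
    ∃ γ ∈ d.group, ∀ᶠ w in 𝓝 u, h w = γ w := by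
  obtain ⟨r, hr, hB⟩ := Metric.isOpen_iff.1 hW u hu
  set B := Metric.ball u r with hBdef
  have hBo : IsOpen B := Metric.isOpen_ball
  have hBc : Convex ℝ B := convex_ball u r
  have huB : u ∈ B := Metric.mem_ball_self hr
  let S : Set (Eu n →L[ℝ] Eu n) := (fun γ : Eu n ≃L[ℝ] Eu n => (γ : Eu n →L[ℝ] Eu n)) '' d.group
  have hS : S.Finite := by
    have := d.finite_group
    exact (Set.toFinite (d.group : Set (Eu n ≃L[ℝ] Eu n))).image _
  have hcont : ContinuousOn (fderiv ℝ h) B :=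
    (hh.mono hB).continuousOn_fderiv_of_isOpen hBo le_rfl
  have hdiff : DifferentiableOn ℝ h B := (hh.mono hB).differentiableOn one_ne_zero
  have hloc : ∀ V ⊆ B, IsOpen V → V.Nonempty →
      ∃ γ ∈ d.group, ∃ v ∈ V, h v = γ v ∧ fderiv ℝ h v = (γ : Eu n →L[ℝ] Eu n) := by
    intro V hV hVo hVn
    obtain ⟨γ, hγ, W', hW', ho', ⟨v, hv⟩, e⟩ := d.exists_eqOn_of_map_eq hVo hVn continuousOn_id
      (hh.continuousOn.mono (hV.trans hB)) ((hV.trans hB).trans hWd)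
      (hhd.mono_left (hV.trans hB)) (fun w hw => (hmap w (hB (hV hw))).symm)
    refine ⟨γ, hγ, v, hW' hv, (e v hv).symm, ?_⟩
    have : h =ᶠ[𝓝 v] fun w => γ w :=
      Filter.eventuallyEq_of_mem (ho'.mem_nhds hv) fun w hw => (e w hw).symm
    rw [this.fderiv_eq]
    exact γ.fderiv
  have hmaps : MapsTo (fderiv ℝ h) B S := by
    intro w hw
    by_contra hwS
    obtain ⟨γ, hγ, v, hv, -, e⟩ := hloc _ inter_subset_left
      (hcont.isOpen_inter_preimage hBo hS.isClosed.isOpen_compl) ⟨w, hw, hwS⟩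
    exact hv.2 (e ▸ mem_image_of_mem _ hγ)
  obtain ⟨γ, hγ, v, hv, e1, e2⟩ := hloc B subset_rfl hBo ⟨u, huB⟩
  have hconst : ∀ w ∈ B, fderiv ℝ h w = (γ : Eu n →L[ℝ] Eu n) := by
    intro w hw
    rw [← e2]
    exact hBc.isPreconnected.constant_of_mapsTo hS.isDiscrete hcont hmaps hw hv
  refine ⟨γ, hγ, Filter.eventually_of_mem (hBo.mem_nhds huB) fun w hw => ?_⟩
  have h2 : ∀ w ∈ B, fderiv ℝ (fun w => h w - γ w) w = 0 := by
    intro w hw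
    have := ((hdiff w hw).differentiableAt (hBo.mem_nhds hw)).hasFDerivAt.sub
      (γ.hasFDerivAt (x := w))
    rw [hconst w hw, sub_self] at this
    exact this.fderiv
  have h3 := hBo.is_const_of_fderiv_eq_zero (𝕜 := ℝ) hBc.isPreconnected
    (hdiff.sub γ.differentiable.differentiableOn) (fun w hw => h2 w hw) hw hv
  have h4 : h w - γ w = h v - γ v := h3
  rw [e1, sub_self] at h4
  exact sub_eq_zero.1 h4

theorem IsTransition.symm {c d : OrbifoldChart n X} {h : OpenPartialHomeomorph (Eu n) (Eu n)}
    (hh : IsTransition c d h) : IsTransition d c h.symm where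
  source_subset := hh.target_subset
  target_subset := hh.source_subset
  contDiffOn := hh.contDiffOn_symm
  contDiffOn_symm := by simpa using hh.contDiffOn
  map_eq := by
    intro v hv
    have hv' : v ∈ h.target := hv
    rw [← hh.map_eq _ (h.map_target hv'), h.right_inv hv']

/-- A transition conjugates isotropy groups. -/
theorem IsTransition.exists_conj {c d : OrbifoldChart n X}
    {h : OpenPartialHomeomorph (Eu n) (Eu n)} (hh : IsTransition c d h) {z : Eu n}
    (hz : z ∈ h.source) {γ : Eu n ≃L[ℝ] Eu n} (hγ : γ ∈ c.group) (hγz : γ z = z) :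
    ∃ γ' ∈ d.group, ∀ᶠ w in 𝓝 z, h (γ w) = γ' (h w) := by
  have hzt : h z ∈ h.target := h.map_source hz
  have ho : IsOpen (h.target ∩ h.symm ⁻¹' (γ ⁻¹' h.source)) :=
    h.symm.isOpen_inter_preimage (h.open_source.preimage γ.continuous)
  have hmem : h z ∈ h.target ∩ h.symm ⁻¹' (γ ⁻¹' h.source) := by
    refine ⟨hzt, ?_⟩
    simp only [mem_preimage, h.left_inv hz, hγz, hz]
  obtain ⟨γ', hγ', e⟩ := d.exists_eventuallyEq_of_map_eq (h := fun v => h (γ (h.symm v))) ho hmem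
    (inter_subset_left.trans hh.target_subset)
    (((hh.contDiffOn.comp (γ.contDiff.comp_contDiffOn (hh.contDiffOn_symm.mono inter_subset_left))
      (fun v hv => hv.2)).of_le (by simp)))
    (fun v hv => hh.target_subset (h.map_source hv.2))
    (fun v hv => by
      have h1 := h.map_target hv.1
      rw [hh.map_eq _ hv.2, c.map_apply hγ (hh.source_subset h1), ← hh.map_eq _ h1,
        h.right_inv hv.1])
  refine ⟨γ', hγ', ?_⟩
  have h1 := (h.continuousAt hz).eventually e
  filter_upwards [h1, h.open_source.mem_nhds hz] with w hw hws
  rwa [h.left_inv hws] at hw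

theorem ContinuousLinearEquiv.eq_of_eventuallyEq {V W : Type*} [NormedAddCommGroup V]
    [NormedSpace ℝ V] [NormedAddCommGroup W] [NormedSpace ℝ W] {a b : V ≃L[ℝ] W} {u : V}
    (h : ∀ᶠ w in 𝓝 u, a w = b w) : a = b := by
  have h1 : fderiv ℝ (fun w => a w) u = fderiv ℝ (fun w => b w) u := Filter.EventuallyEq.fderiv_eq h
  have h2 : (a : V →L[ℝ] W) = (b : V →L[ℝ] W) := by
    rw [← a.fderiv (x := u), ← b.fderiv (x := u)]
    exact h1
  ext v
  exact DFunLike.congr_fun h2 v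

end Lifts

/-! ### Suborbifold charts -/

section LocalSection

theorem exists_local_section {n k q : ℕ} {F : Eu n → Fin q → ℝ} {ρ : Eu n →L[ℝ] Eu k} {z : Eu n} {Ω : Set (Eu n)} (hΩ : IsOpen Ω)
    (hz : z ∈ Ω) (hF : ContDiffOn ℝ ∞ F Ω) (hbij : Function.Bijective (ρ.prod (fderiv ℝ F z))) :
    ∃ Ω' ⊆ Ω, IsOpen Ω' ∧ z ∈ Ω' ∧ ∃ j : Eu k → Eu n, ∀ V ⊆ Ω', IsOpen V →
      IsOpen (ρ '' (V ∩ F ⁻¹' {0})) ∧ ContDiffOn ℝ ∞ j (ρ '' (V ∩ F ⁻¹' {0})) ∧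
      ∀ v ∈ V, F v = 0 → j (ρ v) = v := by
  let A : Eu n ≃L[ℝ] Eu k × (Fin q → ℝ) := (LinearEquiv.ofBijective
    (ρ.prod (fderiv ℝ F z)).toLinearMap hbij).toContinuousLinearEquiv
  have hA : (A : Eu n →L[ℝ] Eu k × (Fin q → ℝ)) = ρ.prod (fderiv ℝ F z) := by
    exact ContinuousLinearMap.ext fun v => rfl
  have hFat : ∀ v ∈ Ω, ContDiffAt ℝ ∞ F v := fun v hv => hF.contDiffAt (hΩ.mem_nhds hv)
  let Ψ : Eu n → Eu k × (Fin q → ℝ) := fun v => (ρ v, F v)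
  have hΨ : ∀ v ∈ Ω, ContDiffAt ℝ ∞ Ψ v := fun v hv => ρ.contDiff.contDiffAt.prodMk (hFat v hv)
  have hΨ' : ∀ v ∈ Ω, HasFDerivAt Ψ (fderiv ℝ Ψ v) v := fun v hv =>
    ((hΨ v hv).differentiableAt (by simp)).hasFDerivAt
  have hAz : fderiv ℝ Ψ z = A := by
    rw [hA]
    exact (ρ.hasFDerivAt.prodMk ((hFat z hz).differentiableAt (by simp)).hasFDerivAt).fderiv
  have hΨz : HasFDerivAt Ψ (A : Eu n →L[ℝ] Eu k × (Fin q → ℝ)) z := hAz ▸ hΨ' z hz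
  let Θ := (hΨ z hz).toOpenPartialHomeomorph Ψ hΨz (by simp)
  have hzΘ : z ∈ Θ.source := (hΨ z hz).mem_toOpenPartialHomeomorph_source hΨz (by simp)
  have hinv : ∀ᶠ v in 𝓝 z, fderiv ℝ Ψ v ∈ range
      ((↑) : (Eu n ≃L[ℝ] Eu k × (Fin q → ℝ)) → (Eu n →L[ℝ] Eu k × (Fin q → ℝ))) := by
    have hc : ContinuousAt (fderiv ℝ Ψ) z :=
      ((hΨ z hz).fderiv_right (m := 0) (by simp)).continuousAt
    refine hc.eventually ?_
    rw [hAz]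
    exact A.nhds
  obtain ⟨Ω', hΩ'sub, hΩ'o, hzΩ'⟩ := mem_nhds_iff.1
    (Filter.inter_mem hinv (Filter.inter_mem (Θ.open_source.mem_nhds hzΘ) (hΩ.mem_nhds hz)))
  have hsrc : Ω' ⊆ Θ.source := fun v hv => (hΩ'sub hv).2.1
  refine ⟨Ω', fun v hv => (hΩ'sub hv).2.2, hΩ'o, hzΩ', fun w => Θ.symm (w, 0),
    fun V hV hVo => ?_⟩
  have himg : ρ '' (V ∩ F ⁻¹' {0}) = (fun w : Eu k => ((w, 0) : Eu k × (Fin q → ℝ))) ⁻¹' (Θ '' V) := by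
    ext w
    constructor
    · rintro ⟨v, ⟨hv, hv0⟩, rfl⟩
      exact ⟨v, hv, Prod.ext rfl hv0⟩
    · rintro ⟨v, hv, e⟩
      exact ⟨v, ⟨hv, congrArg Prod.snd e⟩, congrArg Prod.fst e⟩
  have hj : ∀ v ∈ V, F v = 0 → Θ.symm (ρ v, 0) = v := by
    intro v hv hv0
    have : ((ρ v, 0) : Eu k × (Fin q → ℝ)) = Θ v := Prod.ext rfl hv0.symm
    rw [this, Θ.left_inv (hsrc (hV hv))]
  refine ⟨?_, ?_, hj⟩
  · rw [himg]
    exact (Θ.isOpen_image_of_subset_source hVo (hV.trans hsrc)).preimage (by fun_prop)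
  · rintro w ⟨v, ⟨hv, hv0⟩, rfl⟩
    have hv0' : F v = 0 := hv0
    have hsymm : Θ.symm (ρ v, 0) = v := hj v hv hv0'
    obtain ⟨B, hB⟩ := (hΩ'sub (hV hv)).1
    have hvΩ := (hΩ'sub (hV hv)).2.2
    have h1 : ContDiffAt ℝ ∞ Θ.symm (ρ v, 0) := by
      refine Θ.contDiffAt_symm (f₀' := B) ?_ ?_ ?_
      · have : ((ρ v, 0) : Eu k × (Fin q → ℝ)) = Θ v := Prod.ext rfl hv0'.symm
        rw [this]
        exact Θ.map_source (hsrc (hV hv))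
      · rw [hsymm, hB]
        exact hΨ' v hvΩ
      · rw [hsymm]
        exact hΨ v hvΩ
    have h2 : ContDiffAt ℝ ∞ (fun w : Eu k => ((w, 0) : Eu k × (Fin q → ℝ))) (ρ v) := by fun_prop
    exact (ContDiffAt.comp (ρ v) h1 h2).contDiffWithinAt

theorem exists_linear_section {n k q : ℕ} (hn : k + q = n) {D : Eu n →L[ℝ] Fin q → ℝ}
    {T : (Fin q → ℝ) →L[ℝ] Eu n} (hbij : Function.Bijective (D.comp T)) :
    ∃ (ρ : Eu n →L[ℝ] Eu k) (s : Eu k →L[ℝ] Eu n), (∀ w, ρ (s w) = w) ∧ (∀ w, D (s w) = 0) ∧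
      (∀ e, ρ (T e) = 0) ∧ ∀ v, ∃ e, v = s (ρ v) + T e := by
  let A := LinearEquiv.ofBijective (D.comp T).toLinearMap hbij
  have hA : ∀ e, A e = D (T e) := fun e => rfl
  let K := LinearMap.ker D.toLinearMap
  have hsurj : LinearMap.range D.toLinearMap = ⊤ := by
    rw [LinearMap.range_eq_top]
    intro e
    obtain ⟨e', he'⟩ := hbij.2 e
    exact ⟨T e', he'⟩
  have hK : Module.finrank ℝ K = Module.finrank ℝ (Eu k) := by
    have := LinearMap.finrank_range_add_finrank_ker D.toLinearMap
    rw [hsurj, finrank_top] at this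
    simp only [Module.finrank_fintype_fun_eq_card, Fintype.card_fin, finrank_euclideanSpace] at this
    simp only [finrank_euclideanSpace, Fintype.card_fin]
    change q + Module.finrank ℝ K = n at this
    omega
  let e := LinearEquiv.ofFinrankEq K (Eu k) hK
  let P : Eu n →ₗ[ℝ] K := LinearMap.codRestrict K
    (LinearMap.id - T.toLinearMap ∘ₗ A.symm.toLinearMap ∘ₗ D.toLinearMap) (by
      intro v
      change D (v - T (A.symm (D v))) = 0
      rw [map_sub, ← hA, LinearEquiv.apply_symm_apply, sub_self])
  have hP : ∀ v, (P v : Eu n) = v - T (A.symm (D v)) := fun v => rfl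
  have hPK : ∀ v : K, P v = v := by
    intro v
    have hv : D (v : Eu n) = 0 := v.2
    ext1
    rw [hP, hv, map_zero, map_zero, sub_zero]
  refine ⟨LinearMap.toContinuousLinearMap (e.toLinearMap ∘ₗ P),
    LinearMap.toContinuousLinearMap (K.subtype ∘ₗ e.symm.toLinearMap), ?_, ?_, ?_, ?_⟩
  · intro w
    change e (P (e.symm w : Eu n)) = w
    rw [hPK, LinearEquiv.apply_symm_apply]
  · intro w
    exact (e.symm w).2
  · intro t
    change e (P (T t)) = 0
    have : P (T t) = 0 := by
      ext1
      rw [hP, ← hA, LinearEquiv.symm_apply_apply, sub_self]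
      rfl
    rw [this, map_zero]
  · intro v
    refine ⟨A.symm (D v), ?_⟩
    change v = (e.symm (e (P v)) : Eu n) + _
    rw [LinearEquiv.symm_apply_apply, hP, sub_add_cancel]

end LocalSection

section AdaptedChart

variable {n k : ℕ} {X : Type*} [TopologicalSpace X] {Y : Type*} [TopologicalSpace Y]

theorem OrbifoldChart.exists_invariant_nhds (d : OrbifoldChart n X) (z : Eu n) {s : Set (Eu n)}
    (hs : s ∈ 𝓝 z) :
    ∃ V ⊆ s, IsOpen V ∧ z ∈ V ∧ (∀ γ ∈ d.group, γ z = z → ∀ v ∈ V, γ v ∈ V) ∧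
      ∀ γ ∈ d.group, ∀ v ∈ V, γ v ∈ V → γ z = z := by
  have hfin : (d.group : Set (Eu n ≃L[ℝ] Eu n)).Finite := by
    have := d.finite_group
    exact Set.toFinite _
  have h1 : ∀ᶠ p : Eu n × Eu n in 𝓝 z ×ˢ 𝓝 z, ∀ γ ∈ (d.group : Set (Eu n ≃L[ℝ] Eu n)),
      γ z ≠ z → γ p.1 ≠ p.2 := by
    rw [Filter.eventually_all_finite hfin]
    intro γ _
    by_cases h : γ z = z
    · simp [h]
    · rw [← nhds_prod_eq]
      have ho : IsOpen {p : Eu n × Eu n | γ p.1 ≠ p.2} :=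
        isOpen_ne_fun (γ.continuous.comp continuous_fst) continuous_snd
      filter_upwards [ho.mem_nhds (show (z, z) ∈ {p : Eu n × Eu n | γ p.1 ≠ p.2} from h)] with p hp _
      exact hp
  obtain ⟨t, ht, hsep⟩ := Filter.eventually_prod_self_iff
    (r := fun v w => ∀ γ ∈ (d.group : Set (Eu n ≃L[ℝ] Eu n)), γ z ≠ z → γ v ≠ w) |>.1 h1
  obtain ⟨V₁, hV₁, ho₁, hz₁⟩ := mem_nhds_iff.1 (Filter.inter_mem hs ht)
  let Γ : Set (Eu n ≃L[ℝ] Eu n) := {γ | γ ∈ d.group ∧ γ z = z}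
  have hΓ : Γ.Finite := hfin.subset fun γ h => h.1
  have hsub : (⋂ γ ∈ Γ, γ ⁻¹' V₁) ⊆ V₁ := fun v hv => by
    have := mem_iInter₂.1 hv 1 ⟨d.group.one_mem, rfl⟩
    exact this
  refine ⟨⋂ γ ∈ Γ, γ ⁻¹' V₁, fun v hv => (hV₁ (hsub hv)).1,
    hΓ.isOpen_biInter fun γ _ => ho₁.preimage γ.continuous, ?_, ?_, ?_⟩
  · refine mem_iInter₂.2 fun γ hγ => ?_
    rw [mem_preimage, hγ.2]
    exact hz₁
  · intro γ hγ hγz v hv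
    refine mem_iInter₂.2 fun γ' hγ' => ?_
    refine mem_iInter₂.1 hv (γ' * γ) ⟨d.group.mul_mem hγ'.1 hγ, ?_⟩
    change γ' (γ z) = z
    rw [hγz, hγ'.2]
  · intro γ hγ v hv hγv
    by_contra hne
    exact hsep v (hV₁ (hsub hv)).2 _ (hV₁ (hsub hγv)).2 γ hγ hne rfl

/-- `F` defines the subset `R` of `X` near the point `z` of a uniformizing chart, and the
structure group acts trivially on a complement of the kernel of its derivative. -/
structure OrbifoldChart.IsLocalModel (d : OrbifoldChart n X) (R : Set X) {q : ℕ} (z : Eu n)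
    (F : Eu n → Fin q → ℝ) (T : (Fin q → ℝ) →L[ℝ] Eu n) : Prop where
  contDiffOn : ContDiffOn ℝ ∞ F d.domain
  invariant : ∀ γ ∈ d.group, ∀ v ∈ d.domain, F (γ v) = F v
  eventually_iff : ∀ᶠ v in 𝓝 z, d.map v ∈ R ↔ F v = 0
  bijective : Function.Bijective ((fderiv ℝ F z).comp T)
  fixes : ∀ γ ∈ d.group, γ z = z → ∀ e, γ (T e) = T e

/-- A uniformizing chart `c` of `Y` that arises from a uniformizing chart `d` of `X`: `f : Y → X`
lifts to a section `j` of a linear map `ρ`, onto the preimage of `f(Y)` in an open set `V`. -/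
structure OrbifoldChart.IsAdapted (d : OrbifoldChart n X) (f : Y → X) (c : OrbifoldChart k Y)
    (V : Set (Eu n)) (j : Eu k → Eu n) (ρ : Eu n →L[ℝ] Eu k) : Prop where
  isOpen : IsOpen V
  subset : V ⊆ d.domain
  mapsTo : MapsTo j c.domain V
  contDiffOn : ContDiffOn ℝ ∞ j c.domain
  left_inv : ∀ w ∈ c.domain, ρ (j w) = w
  map_eq : ∀ w ∈ c.domain, d.map (j w) = f (c.map w)
  right_inv : ∀ v ∈ V, d.map v ∈ range f → ρ v ∈ c.domain ∧ j (ρ v) = v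
  exists_lift : ∀ γ ∈ c.group, ∃ γ' ∈ d.group, ∀ w ∈ c.domain, j (γ w) = γ' (j w)
  exists_descent : ∀ γ' ∈ d.group, (∃ w ∈ c.domain, γ' (j w) = j w) →
    ∃ γ ∈ c.group, ∀ w ∈ c.domain, j (γ w) = γ' (j w)
  faithful : ∀ γ' ∈ d.group, (∀ w ∈ c.domain, γ' (j w) = j w) → γ' = 1

/-- The automorphisms of `ℝᵏ` induced via `ρ` by the elements of `Γ` that fix `z`. -/
def inducedGroup (Γ : Subgroup (Eu n ≃L[ℝ] Eu n)) (z : Eu n) (ρ : Eu n →L[ℝ] Eu k) :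
    Subgroup (Eu k ≃L[ℝ] Eu k) where
  carrier := {g | ∃ γ ∈ Γ, γ z = z ∧ ∀ v, ρ (γ v) = g (ρ v)}
  mul_mem' := by
    rintro a b ⟨γ, hγ, hz, h⟩ ⟨γ', hγ', hz', h'⟩
    refine ⟨γ * γ', Γ.mul_mem hγ hγ', ?_, fun v => ?_⟩
    · change γ (γ' z) = z
      rw [hz', hz]
    · change ρ (γ (γ' v)) = a (b (ρ v))
      rw [h, h']
  one_mem' := ⟨1, Γ.one_mem, rfl, fun _ => rfl⟩
  inv_mem' := by
    rintro a ⟨γ, hγ, hz, h⟩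
    refine ⟨γ⁻¹, Γ.inv_mem hγ, ?_, fun v => ?_⟩
    · change γ.symm z = z
      rw [ContinuousLinearEquiv.symm_apply_eq, hz]
    · change ρ (γ.symm v) = a.symm (ρ v)
      rw [ContinuousLinearEquiv.eq_symm_apply, ← h, ContinuousLinearEquiv.apply_symm_apply]

theorem OrbifoldChart.IsLocalModel.exists_adapted {d : OrbifoldChart n X} {f : Y → X}
    (hf : Topology.IsEmbedding f) {q : ℕ} (hn : k + q = n) {z : Eu n} (hz : z ∈ d.domain) {y : Y}
    (hy : d.map z = f y) {F : Eu n → Fin q → ℝ} {T : (Fin q → ℝ) →L[ℝ] Eu n}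
    (h : d.IsLocalModel (range f) z F T) :
    ∃ (c : OrbifoldChart k Y) (V : Set (Eu n)) (j : Eu k → Eu n) (ρ : Eu n →L[ℝ] Eu k),
      d.IsAdapted f c V j ρ ∧ ∃ u ∈ c.domain, c.map u = y := by
  obtain ⟨ρ, s, hρs, hDs, hρT, hdec⟩ := exists_linear_section hn h.bijective
  set D : Eu n →L[ℝ] Fin q → ℝ := fderiv ℝ F z with hD
  have hFz : F z = 0 := (h.eventually_iff.self_of_nhds).1 ⟨y, hy.symm⟩
  have hinj : ∀ e : Fin q → ℝ, D (T e) = 0 → e = 0 := by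
    intro e he
    refine h.bijective.1 ?_
    change D (T e) = D (T 0)
    rw [he, map_zero, map_zero]
  have hzero : ∀ v, ρ v = 0 → D v = 0 → v = 0 := by
    intro v h1 h2
    obtain ⟨e, he⟩ := hdec v
    rw [h1, map_zero, zero_add] at he
    rw [he] at h2
    rw [he, hinj e h2, map_zero]
  have hbij : Function.Bijective (ρ.prod D) := by
    constructor
    · intro v v' hvv'
      have h1 : ρ v = ρ v' := congrArg Prod.fst hvv'
      have h2 : D v = D v' := congrArg Prod.snd hvv'
      exact sub_eq_zero.1 (hzero _ (by rw [map_sub, h1, sub_self]) (by rw [map_sub, h2, sub_self]))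
    · rintro ⟨w, e⟩
      obtain ⟨e', he'⟩ := h.bijective.2 e
      refine ⟨s w + T e', ?_⟩
      refine Prod.ext ?_ ?_
      · change ρ (s w + T e') = w
        rw [map_add, hρs, hρT, add_zero]
      · change D (s w + T e') = e
        rw [map_add, hDs, zero_add]
        exact he'
  -- the isotropy group of `z` and its action on the two summands
  have hfix : ∀ γ ∈ d.group, γ z = z → ∀ v, ρ v = 0 → γ v = v := by
    intro γ hγ hγz v hv
    obtain ⟨e, he⟩ := hdec v
    rw [hv, map_zero, zero_add] at he
    rw [he, h.fixes γ hγ hγz]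
  have hDγ : ∀ γ ∈ d.group, γ z = z → ∀ v, D (γ v) = D v := by
    intro γ hγ hγz v
    have h1 : (fun v => F (γ v)) =ᶠ[𝓝 z] F :=
      Filter.eventuallyEq_of_mem (d.isOpen_domain.mem_nhds hz) fun v hv => h.invariant γ hγ v hv
    have h2 := h1.fderiv_eq (𝕜 := ℝ)
    have h3 : HasFDerivAt F D (γ z) := by
      rw [hγz]
      exact ((h.contDiffOn.contDiffAt (d.isOpen_domain.mem_nhds hz)).differentiableAt
        (by simp)).hasFDerivAt
    have h4 := (h3.comp z γ.hasFDerivAt).fderiv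
    have h5 : D.comp (γ : Eu n →L[ℝ] Eu n) = D := h4.symm.trans h2
    exact DFunLike.congr_fun h5 v
  have hsγ : ∀ γ ∈ d.group, γ z = z → ∀ w w', ρ (γ (s w)) = w' → γ (s w) = s w' := by
    intro γ hγ hγz w w' hw
    refine sub_eq_zero.1 (hzero _ ?_ ?_)
    · rw [map_sub, hw, hρs, sub_self]
    · rw [map_sub, hDγ γ hγ hγz, hDs, hDs, sub_self]
  have hker : ∀ v, ρ (s (ρ v) - v) = 0 := fun v => by rw [map_sub, hρs, sub_self]
  have hind : ∀ γ ∈ d.group, γ z = z → ∀ v, ρ (γ (s (ρ v))) = ρ (γ v) := by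
    intro γ hγ hγz v
    have := hfix γ hγ hγz _ (hker v)
    rw [map_sub, sub_eq_iff_eq_add] at this
    rw [this, map_add, hker, zero_add]
  have hex : ∀ γ ∈ d.group, γ z = z → ∃ g : Eu k ≃L[ℝ] Eu k, ∀ v, ρ (γ v) = g (ρ v) := by
    intro γ hγ hγz
    have hγz' : γ⁻¹ z = z := by
      change γ.symm z = z
      rw [ContinuousLinearEquiv.symm_apply_eq, hγz]
    refine ⟨ContinuousLinearEquiv.equivOfInverse
      (ρ.comp ((γ : Eu n →L[ℝ] Eu n).comp s)) (ρ.comp ((γ⁻¹ : Eu n ≃L[ℝ] Eu n) ∘L s)) ?_ ?_,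
      fun v => (hind γ hγ hγz v).symm⟩
    · intro w
      change ρ (γ⁻¹ (s (ρ (γ (s w))))) = w
      rw [hind _ (d.group.inv_mem hγ) hγz']
      change ρ (γ.symm (γ (s w))) = w
      rw [ContinuousLinearEquiv.symm_apply_apply, hρs]
    · intro w
      change ρ (γ (s (ρ (γ⁻¹ (s w))))) = w
      rw [hind _ hγ hγz]
      change ρ (γ (γ.symm (s w))) = w
      rw [ContinuousLinearEquiv.apply_symm_apply, hρs]
  have hone : ∀ γ ∈ d.group, γ z = z → (∀ v, ρ (γ v) = ρ v) → γ = 1 := by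
    intro γ hγ hγz hγρ
    ext1
    funext v
    change γ v = v
    obtain ⟨e, he⟩ := hdec v
    have h1 := hsγ γ hγ hγz (ρ v) (ρ v) (by rw [hγρ, hρs])
    conv_lhs => rw [he, map_add, h1, h.fixes γ hγ hγz e, ← he]
  -- the local section
  obtain ⟨Ω', hΩ'd, hΩ'o, hzΩ', j, hj⟩ :=
    exists_local_section d.isOpen_domain hz h.contDiffOn hbij
  obtain ⟨V, hVs, hVo, hzV, hVinv, hVsep⟩ := d.exists_invariant_nhds z
    (Filter.inter_mem (hΩ'o.mem_nhds hzΩ') h.eventually_iff)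
  have hVd : V ⊆ d.domain := fun v hv => hΩ'd (hVs hv).1
  have hR : ∀ v ∈ V, d.map v ∈ range f ↔ F v = 0 := fun v hv => (hVs hv).2
  obtain ⟨hUo, hjc, hjρ⟩ := hj V (fun v hv => (hVs hv).1) hVo
  set U := ρ '' (V ∩ F ⁻¹' {0}) with hU
  have hjV : ∀ w ∈ U, j w ∈ V ∧ F (j w) = 0 ∧ ρ (j w) = w := by
    rintro w ⟨v, ⟨hv, hv0⟩, rfl⟩
    have hv0' : F v = 0 := hv0
    rw [hjρ v hv hv0']
    exact ⟨hv, hv0', rfl⟩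
  have hjR : ∀ w ∈ U, d.map (j w) ∈ range f := fun w hw => (hR _ (hjV w hw).1).2 (hjV w hw).2.1
  have hright : ∀ v ∈ V, d.map v ∈ range f → ρ v ∈ U ∧ j (ρ v) = v := fun v hv hvR =>
    ⟨⟨v, ⟨hv, (hR v hv).1 hvR⟩, rfl⟩, hjρ v hv ((hR v hv).1 hvR)⟩
  have hequiv : ∀ γ ∈ d.group, γ z = z → ∀ g : Eu k ≃L[ℝ] Eu k, (∀ v, ρ (γ v) = g (ρ v)) →
      ∀ w ∈ U, g w ∈ U ∧ j (g w) = γ (j w) := by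
    intro γ hγ hγz g hg w hw
    obtain ⟨h1, h2, h3⟩ := hjV w hw
    have h4 := hright (γ (j w)) (hVinv γ hγ hγz _ h1)
      (by rw [d.map_apply hγ (hVd h1)]; exact hjR w hw)
    rwa [hg, h3] at h4
  classical
  let m : Eu k → Y := fun w => if hw : d.map (j w) ∈ range f then hw.choose else y
  have hm : ∀ w ∈ U, d.map (j w) = f (m w) := by
    intro w hw
    have hw' := hjR w hw
    simp only [m, dif_pos hw']
    exact hw'.choose_spec.symm
  have hmcont : ContinuousOn m U := by
    rw [hf.isInducing.continuousOn_iff]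
    exact (d.continuousOn_map.comp hjc.continuousOn fun w hw => hVd (hjV w hw).1).congr
      fun w hw => (hm w hw).symm
  have hsurjρ : Function.Surjective ρ := fun w => ⟨s w, hρs w⟩
  have huniq : ∀ (γ : Eu n ≃L[ℝ] Eu n) (g g' : Eu k ≃L[ℝ] Eu k), (∀ v, ρ (γ v) = g (ρ v)) →
      (∀ v, ρ (γ v) = g' (ρ v)) → g = g' := by
    intro γ g g' hg hg'
    ext1
    funext w
    obtain ⟨v, rfl⟩ := hsurjρ w
    rw [← hg, hg']
  let c : OrbifoldChart k Y :=
    { domain := U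
      group := inducedGroup d.group z ρ
      map := m
      isOpen_domain := hUo
      finite_group := by
        have := d.finite_group
        choose φ hφ _ hφρ using fun g : inducedGroup d.group z ρ => g.2
        refine Finite.of_injective (fun g => (⟨φ g, hφ g⟩ : d.group)) fun g g' hgg' => ?_
        have e : φ g = φ g' := congrArg Subtype.val hgg'
        exact Subtype.ext (huniq (φ g) g g' (hφρ g) (e ▸ hφρ g'))
      apply_mem := by
        rintro g ⟨γ, hγ, hγz, hg⟩ w hw
        exact (hequiv γ hγ hγz g hg w hw).1
      codim_fixed := by
        rintro g ⟨γ, hγ, hγz, hg⟩ hg1 -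
        have hγ1 : γ ≠ 1 := by
          rintro rfl
          exact hg1 (huniq 1 g 1 hg fun _ => rfl)
        have h1 := d.codim_fixed γ hγ hγ1 ⟨z, hz, hγz⟩
        set K := LinearMap.ker ((γ : Eu n →L[ℝ] Eu n).toLinearMap - LinearMap.id)
        set L := LinearMap.ker ((g : Eu k →L[ℝ] Eu k).toLinearMap - LinearMap.id)
        let φ : L × (Fin q → ℝ) →ₗ[ℝ] K := LinearMap.codRestrict K
          ((s.toLinearMap ∘ₗ L.subtype).coprod T.toLinearMap) (by
            rintro ⟨w, e⟩
            have hw : g w - w = 0 := w.2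
            change γ (s w + T e) - (s w + T e) = 0
            rw [map_add, h.fixes γ hγ hγz e,
              hsγ γ hγ hγz w w (by rw [hg, hρs]; exact sub_eq_zero.1 hw), sub_self])
        have hφ : Function.Injective φ := by
          rw [← LinearMap.ker_eq_bot, LinearMap.ker_eq_bot']
          rintro ⟨w, e⟩ h0
          have h0' : s w + T e = 0 := congrArg Subtype.val h0
          have hw : (w : Eu k) = 0 := by
            have := congrArg ρ h0'
            rwa [map_add, hρs, hρT, add_zero, map_zero] at this
          have he : e = 0 := by
            refine hinj e ?_
            rw [hw, map_zero, zero_add] at h0'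
            rw [h0', map_zero]
          exact Prod.ext (Subtype.ext hw) he
        have h2 := LinearMap.finrank_le_finrank_of_injective hφ
        rw [Module.finrank_prod, Module.finrank_fintype_fun_eq_card, Fintype.card_fin] at h2
        omega
      continuousOn_map := hmcont
      isOpen_image := by
        intro V' hV' hV'o
        rw [hf.isInducing.isOpen_iff]
        refine ⟨d.map '' (V ∩ ρ ⁻¹' V'), d.isOpen_image _ (inter_subset_left.trans hVd)
          (hVo.inter (hV'o.preimage ρ.continuous)), ?_⟩
        ext y'
        constructor
        · rintro ⟨v, ⟨hv, hvV'⟩, e⟩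
          refine ⟨ρ v, hvV', hf.injective ?_⟩
          rw [← hm _ (hV' hvV'), (hright v hv ⟨y', e.symm⟩).2, e]
        · rintro ⟨w, hw, rfl⟩
          obtain ⟨h1, h2, h3⟩ := hjV w (hV' hw)
          refine ⟨j w, ⟨h1, ?_⟩, hm w (hV' hw)⟩
          rw [mem_preimage, h3]
          exact hw
      map_eq_iff := by
        intro w hw w' hw'
        obtain ⟨h1, h2, h3⟩ := hjV w hw
        obtain ⟨h1', h2', h3'⟩ := hjV w' hw'
        rw [← hf.injective.eq_iff, ← hm w hw, ← hm w' hw', d.map_eq_iff _ (hVd h1) _ (hVd h1')]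
        constructor
        · rintro ⟨γ, hγ, e⟩
          have hγz := hVsep γ hγ _ h1 (e ▸ h1')
          obtain ⟨g, hg⟩ := hex γ hγ hγz
          refine ⟨g, ⟨γ, hγ, hγz, hg⟩, ?_⟩
          rw [← h3, ← hg, e, h3']
        · rintro ⟨g, ⟨γ, hγ, hγz, hg⟩, rfl⟩
          exact ⟨γ, hγ, (hequiv γ hγ hγz g hg w hw).2.symm⟩ }
  have hzρ := hright z hzV ⟨y, hy.symm⟩
  refine ⟨c, V, j, ρ, ?_, ρ z, hzρ.1, ?_⟩
  · exact
      { isOpen := hVo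
        subset := hVd
        mapsTo := fun w hw => (hjV w hw).1
        contDiffOn := hjc
        left_inv := fun w hw => (hjV w hw).2.2
        map_eq := hm
        right_inv := hright
        exists_lift := by
          rintro g ⟨γ, hγ, hγz, hg⟩
          exact ⟨γ, hγ, fun w hw => (hequiv γ hγ hγz g hg w hw).2⟩
        exists_descent := by
          rintro γ hγ ⟨w, hw, e⟩
          have hγz := hVsep γ hγ _ (hjV w hw).1 (e.symm ▸ (hjV w hw).1)
          obtain ⟨g, hg⟩ := hex γ hγ hγz
          exact ⟨g, ⟨γ, hγ, hγz, hg⟩, fun w hw => (hequiv γ hγ hγz g hg w hw).2⟩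
        faithful := by
          intro γ hγ hfixγ
          have hγz : γ z = z := by
            have := hfixγ _ hzρ.1
            rwa [hzρ.2] at this
          obtain ⟨g, hg⟩ := hex γ hγ hγz
          have hg1 : g = 1 := by
            refine ContinuousLinearEquiv.eq_of_eventuallyEq (u := ρ z)
              (Filter.eventually_of_mem (hUo.mem_nhds hzρ.1) fun w hw => ?_)
            obtain ⟨h1, h2, h3⟩ := hjV w hw
            change g w = w
            rw [← h3, ← hg, hfixγ w hw]
          exact hone γ hγ hγz fun v => by rw [hg, hg1]; rfl }
  · apply hf.injective
    change f (m (ρ z)) = f y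
    rw [← hm _ hzρ.1, hzρ.2, hy]

end AdaptedChart

/-! ### Suborbifolds -/

section AlternatingPair

variable {V : Type*} [NormedAddCommGroup V] [NormedSpace ℝ V]

theorem ContinuousAlternatingMap.apply_pair_swap (A : V [⋀^Fin 2]→L[ℝ] ℝ) (a b : V) :
    A ![a, b] = -A ![b, a] := by
  have h : A (![b, a] ∘ Equiv.swap 0 1) = -A ![b, a] :=
    A.toAlternatingMap.map_swap ![b, a] (show (0 : Fin 2) ≠ 1 by decide)
  rw [← h]
  congr 1
  ext i : 1
  fin_cases i <;> rfl

theorem ContinuousAlternatingMap.apply_pair_add (A : V [⋀^Fin 2]→L[ℝ] ℝ) (a b c : V) :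
    A ![a, b + c] = A ![a, b] + A ![a, c] := by
  have h := A.map_update_add ![a, 0] 1 b c
  have e : ∀ x, Function.update ![a, 0] 1 x = ![a, x] := fun x => by
    ext i : 1
    fin_cases i <;> rfl
  rwa [e, e, e] at h

end AlternatingPair

section GroupRelation

theorem exists_mulEquiv_of_relation {A B : Type*} [Group A] [Group B] {r : A → B → Prop}
    (hmul : ∀ a b a' b', r a b → r a' b' → r (a * a') (b * b')) (hl : ∀ a, ∃ b, r a b)
    (hr : ∀ b, ∃ a, r a b) (hul : ∀ a b b', r a b → r a b' → b = b')
    (hur : ∀ a a' b, r a b → r a' b → a = a') : ∃ θ : A ≃* B, ∀ a, r a (θ a) := by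
  choose φ hφ using hl
  choose ψ hψ using hr
  exact ⟨{ toFun := φ
           invFun := ψ
           left_inv := fun a => hur _ _ _ (hψ _) (hφ a)
           right_inv := fun b => hul _ _ _ (hφ _) (hψ b)
           map_mul' := fun a a' => hul _ _ _ (hφ _) (hmul _ _ _ _ (hφ a) (hφ a')) }, hφ⟩

end GroupRelation

section Suborbifold

variable {n k : ℕ} {X : Type*} [TopologicalSpace X] {Y : Type*} [TopologicalSpace Y]

theorem Orbifold.Form.pullback_eq_of_lifts {M : Orbifold n X} {p : ℕ} (σ : M.Form p)
    {d d' : OrbifoldChart n X} (hd : d ∈ M.atlas) (hd' : d' ∈ M.atlas) {W : Set (Eu k)}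
    (hW : IsOpen W) {f g : Eu k → Eu n}
    (hf : ContDiffOn ℝ ∞ f W) (hg : ContDiffOn ℝ ∞ g W) (hfd : MapsTo f W d.domain)
    (hgd : MapsTo g W d'.domain) (h : ∀ w ∈ W, d.map (f w) = d'.map (g w)) {w : Eu k} (hw : w ∈ W) :
    (σ.form d (f w)).compContinuousLinearMap (fderiv ℝ f w) =
      (σ.form d' (g w)).compContinuousLinearMap (fderiv ℝ g w) := by
  obtain ⟨φ, hφ, hs, e⟩ := M.compatible d hd d' hd' _ (hfd hw) _ (hgd hw) (h w hw)
  have ho : IsOpen (W ∩ f ⁻¹' φ.source) := hf.continuousOn.isOpen_inter_preimage hW φ.open_source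
  have h1 := σ.pullback_eq_of_map_eq hd' ho (f := fun w => φ (f w)) (g := g)
    (hφ.contDiffOn.comp (hf.mono inter_subset_left) fun w hw => hw.2) (hg.mono inter_subset_left)
    (fun w hw => hφ.target_subset (φ.map_source hw.2)) (hgd.mono_left inter_subset_left)
    (fun w hw => by rw [hφ.map_eq _ hw.2, h w hw.1]) ⟨hw, hs⟩
  have hc := fderiv_comp w ((hφ.contDiffOn.contDiffAt (φ.open_source.mem_nhds hs)).differentiableAt
    (by simp)) ((hf.contDiffAt (hW.mem_nhds hw)).differentiableAt (by simp))
  have hc' : fderiv ℝ (fun w => φ (f w)) w = (fderiv ℝ φ (f w)).comp (fderiv ℝ f w) := hc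
  rw [← h1, hc', σ.pullback d hd d' hd' φ hφ _ hs]
  rfl

namespace OrbifoldChart.IsAdapted

variable {f : Y → X} {d d' : OrbifoldChart n X} {c c' : OrbifoldChart k Y} {V V' : Set (Eu n)}
  {j j' : Eu k → Eu n} {ρ ρ' : Eu n →L[ℝ] Eu k}

theorem transition_apply (h : d.IsAdapted f c V j ρ) (h' : d'.IsAdapted f c' V' j' ρ')
    (hf : Function.Injective f) {φ : OpenPartialHomeomorph (Eu n) (Eu n)}
    (hφ : IsTransition d d' φ) {w : Eu k} (hw : w ∈ c.domain) (hs : j w ∈ φ.source)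
    (hV : φ (j w) ∈ V') :
    ρ' (φ (j w)) ∈ c'.domain ∧ j' (ρ' (φ (j w))) = φ (j w) ∧ c'.map (ρ' (φ (j w))) = c.map w := by
  have e : d'.map (φ (j w)) = f (c.map w) := by rw [hφ.map_eq _ hs, h.map_eq _ hw]
  obtain ⟨h1, h2⟩ := h'.right_inv _ hV ⟨_, e.symm⟩
  refine ⟨h1, h2, hf ?_⟩
  rw [← h'.map_eq _ h1, h2, e]

theorem isOpen_preimage (h : d.IsAdapted f c V j ρ) {s : Set (Eu n)} (hs : IsOpen s) :
    IsOpen (c.domain ∩ j ⁻¹' s) :=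
  h.contDiffOn.continuousOn.isOpen_inter_preimage c.isOpen_domain hs

theorem exists_transition (h : d.IsAdapted f c V j ρ) (h' : d'.IsAdapted f c' V' j' ρ')
    (hf : Function.Injective f) {φ : OpenPartialHomeomorph (Eu n) (Eu n)}
    (hφ : IsTransition d d' φ) {u u' : Eu k} (hu : u ∈ c.domain) (hu' : u' ∈ c'.domain)
    (hs : j u ∈ φ.source) (e : φ (j u) = j' u') :
    ∃ ψ : OpenPartialHomeomorph (Eu k) (Eu k), IsTransition c c' ψ ∧ u ∈ ψ.source ∧ ψ u = u' := by
  have hS : IsOpen (c.domain ∩ j ⁻¹' (φ.source ∩ φ ⁻¹' V')) :=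
    h.isOpen_preimage (φ.isOpen_inter_preimage h'.isOpen)
  have hT : IsOpen (c'.domain ∩ j' ⁻¹' (φ.target ∩ φ.symm ⁻¹' V)) :=
    h'.isOpen_preimage (φ.symm.isOpen_inter_preimage h.isOpen)
  have h1 : ContDiffOn ℝ ∞ (fun w => ρ' (φ (j w))) (c.domain ∩ j ⁻¹' (φ.source ∩ φ ⁻¹' V')) :=
    ρ'.contDiff.comp_contDiffOn
      (hφ.contDiffOn.comp (h.contDiffOn.mono inter_subset_left) fun w hw => hw.2.1)
  have h2 : ContDiffOn ℝ ∞ (fun w => ρ (φ.symm (j' w)))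
      (c'.domain ∩ j' ⁻¹' (φ.target ∩ φ.symm ⁻¹' V)) :=
    ρ.contDiff.comp_contDiffOn
      (hφ.contDiffOn_symm.comp (h'.contDiffOn.mono inter_subset_left) fun w hw => hw.2.1)
  let ψ : OpenPartialHomeomorph (Eu k) (Eu k) :=
    { toFun := fun w => ρ' (φ (j w))
      invFun := fun w => ρ (φ.symm (j' w))
      source := c.domain ∩ j ⁻¹' (φ.source ∩ φ ⁻¹' V')
      target := c'.domain ∩ j' ⁻¹' (φ.target ∩ φ.symm ⁻¹' V)
      map_source' := by
        rintro w ⟨hw, hws, hwV⟩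
        obtain ⟨a1, a2, -⟩ := h.transition_apply h' hf hφ hw hws hwV
        refine ⟨a1, ?_⟩
        rw [mem_preimage, a2]
        refine ⟨φ.map_source hws, ?_⟩
        rw [mem_preimage, φ.left_inv hws]
        exact h.mapsTo hw
      map_target' := by
        rintro w ⟨hw, hws, hwV⟩
        obtain ⟨a1, a2, -⟩ := h'.transition_apply h hf hφ.symm hw hws hwV
        refine ⟨a1, ?_⟩
        rw [mem_preimage, a2]
        refine ⟨φ.map_target hws, ?_⟩
        rw [mem_preimage, φ.right_inv hws]
        exact h'.mapsTo hw
      left_inv' := by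
        rintro w ⟨hw, hws, hwV⟩
        obtain ⟨-, a2, -⟩ := h.transition_apply h' hf hφ hw hws hwV
        rw [a2, φ.left_inv hws, h.left_inv _ hw]
      right_inv' := by
        rintro w ⟨hw, hws, hwV⟩
        obtain ⟨-, a2, -⟩ := h'.transition_apply h hf hφ.symm hw hws hwV
        rw [a2, φ.right_inv hws, h'.left_inv _ hw]
      open_source := hS
      open_target := hT
      continuousOn_toFun := h1.continuousOn
      continuousOn_invFun := h2.continuousOn }
  refine ⟨ψ, ⟨inter_subset_left, inter_subset_left, h1, h2, ?_⟩, ⟨hu, hs, ?_⟩, ?_⟩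
  · rintro w ⟨hw, hws, hwV⟩
    exact (h.transition_apply h' hf hφ hw hws hwV).2.2
  · rw [mem_preimage, e]
    exact h'.mapsTo hu'
  · change ρ' (φ (j u)) = u'
    rw [e, h'.left_inv _ hu']

end OrbifoldChart.IsAdapted

namespace Orbifold

variable (M : Orbifold n X) (f : Y → X)

/-- The uniformizing charts of `Y` that are adapted to some chart of `M`. -/
def adaptedCharts (k : ℕ) : Set (OrbifoldChart k Y) :=
  {c | ∃ d ∈ M.atlas, ∃ V j ρ, d.IsAdapted f c V j ρ}

/-- The orbifold structure on `Y` given by the adapted charts. -/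
def suborbifold (hf : Function.Injective f)
    (hc : ∀ y : Y, ∃ c ∈ M.adaptedCharts f k, ∃ u ∈ c.domain, c.map u = y) : Orbifold k Y where
  atlas := M.adaptedCharts f k
  cover := hc
  compatible := by
    rintro c ⟨d, hd, V, j, ρ, h⟩ c' ⟨d', hd', V', j', ρ', h'⟩ u hu u' hu' e
    obtain ⟨φ, hφ, hs, e'⟩ := M.compatible d hd d' hd' _ (h.subset (h.mapsTo hu)) _
      (h'.subset (h'.mapsTo hu')) (by rw [h.map_eq _ hu, h'.map_eq _ hu', e])
    exact h.exists_transition h' hf hφ hu hu' hs e'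

variable {M f}

theorem suborbifold_isEmbedding (hf : Topology.IsEmbedding f)
    (hc : ∀ y : Y, ∃ c ∈ M.adaptedCharts f k, ∃ u ∈ c.domain, c.map u = y) :
    (M.suborbifold f hf.injective hc).IsEmbedding M f where
  isEmbedding := hf
  exists_lift := by
    rintro c ⟨d₀, hd₀, V, j, ρ, h⟩ d hd u hu v hv e
    obtain ⟨φ, hφ, hs, rfl⟩ := M.compatible d₀ hd₀ d hd _ (h.subset (h.mapsTo hu)) _ hv
      (by rw [h.map_eq _ hu, e])
    set W := c.domain ∩ j ⁻¹' φ.source with hW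
    have hWo : IsOpen W := h.isOpen_preimage φ.open_source
    have huW : u ∈ W := ⟨hu, hs⟩
    have hJ : ContDiffOn ℝ ∞ (fun w => φ (j w)) W :=
      hφ.contDiffOn.comp (h.contDiffOn.mono inter_subset_left) fun w hw => hw.2
    have hinv : ∀ w ∈ W, ρ (φ.symm (φ (j w))) = w := fun w hw => by
      rw [φ.left_inv hw.2, h.left_inv _ hw.1]
    have hinj : ∀ w ∈ W, ∀ w' ∈ W, φ (j w) = φ (j w') → w = w' := fun w hw w' hw' e => by
      rw [← hinv w hw, e, hinv w' hw']
    have hju : ContinuousAt j u :=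
      h.contDiffOn.continuousOn.continuousAt (c.isOpen_domain.mem_nhds hu)
    have hJu : ContinuousAt (fun w => φ (j w)) u := hJ.continuousOn.continuousAt (hWo.mem_nhds huW)
    have hcu : ∀ᶠ w in 𝓝 u, w ∈ W := hWo.mem_nhds huW
    have hback : ∀ γ' ∈ d.group, γ' (φ (j u)) = φ (j u) → ∃ γ₀ ∈ d₀.group, ∃ γ ∈ c.group,
        γ u = u ∧ (∀ w ∈ c.domain, j (γ w) = γ₀ (j w)) ∧
        ∀ᶠ v in 𝓝 (φ (j u)), φ.symm (γ' v) = γ₀ (φ.symm v) := by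
      intro γ' hγ' hfix
      obtain ⟨γ₀, hγ₀, e₀⟩ := hφ.symm.exists_conj (φ.map_source hs) hγ' hfix
      have h0 : γ₀ (j u) = j u := by
        have := e₀.self_of_nhds
        rw [hfix, φ.left_inv hs] at this
        exact this.symm
      obtain ⟨γ, hγ, hγj⟩ := h.exists_descent γ₀ hγ₀ ⟨u, hu, h0⟩
      refine ⟨γ₀, hγ₀, γ, hγ, ?_, hγj, e₀⟩
      rw [← h.left_inv _ (c.apply_mem γ hγ u hu), hγj u hu, h0, h.left_inv _ hu]
    have hfaith : ∀ γ' ∈ d.group, (∀ᶠ w in 𝓝 u, γ' (φ (j w)) = φ (j w)) → γ' = 1 := by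
      intro γ' hγ' hev
      obtain ⟨γ₀, hγ₀, γ, hγ, hγu, hγj, e₀⟩ := hback γ' hγ' hev.self_of_nhds
      have hγ1 : γ = 1 := by
        refine ContinuousLinearEquiv.eq_of_eventuallyEq (u := u) ?_
        filter_upwards [hev, hcu, hJu.eventually e₀] with w h1 h2 h3
        rw [h1, φ.left_inv h2.2] at h3
        change γ w = w
        rw [← h.left_inv _ (c.apply_mem γ hγ w h2.1), hγj w h2.1, ← h3, h.left_inv _ h2.1]
      have hγ₀1 : γ₀ = 1 := h.faithful γ₀ hγ₀ fun w hw => by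
        rw [← hγj w hw, hγ1]
        rfl
      refine ContinuousLinearEquiv.eq_of_eventuallyEq (u := φ (j u)) ?_
      have ht : ∀ᶠ v in 𝓝 (φ (j u)), v ∈ φ.target ∧ γ' v ∈ φ.target := by
        refine Filter.Eventually.and (φ.open_target.mem_nhds (φ.map_source hs)) ?_
        refine γ'.continuous.continuousAt.eventually ?_
        rw [hev.self_of_nhds]
        exact φ.open_target.mem_nhds (φ.map_source hs)
      filter_upwards [e₀, ht] with v h1 h2
      rw [hγ₀1] at h1
      exact φ.symm.injOn h2.2 h2.1 h1
    refine ⟨W, φ '' (V ∩ φ.source), fun w => φ (j w), hWo, huW, inter_subset_left,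
      φ.isOpen_image_of_subset_source (h.isOpen.inter φ.open_source) inter_subset_right,
      ⟨j u, ⟨h.mapsTo hu, hs⟩, rfl⟩, ?_, hJ, ?_, ?_, rfl, ?_, ?_, ?_⟩
    · rintro _ ⟨z, hz, rfl⟩
      exact hφ.target_subset (φ.map_source hz.2)
    · intro w hw
      have h1 : HasFDerivAt (fun w => φ (j w)) (fderiv ℝ (fun w => φ (j w)) w) w :=
        ((hJ.contDiffAt (hWo.mem_nhds hw)).differentiableAt (by simp)).hasFDerivAt
      have h2 : HasFDerivAt φ.symm (fderiv ℝ φ.symm (φ (j w))) (φ (j w)) :=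
        ((hφ.contDiffOn_symm.contDiffAt (φ.open_target.mem_nhds
          (φ.map_source hw.2))).differentiableAt (by simp)).hasFDerivAt
      have h3 := (ρ.hasFDerivAt.comp _ h2).comp w h1
      have h4 : HasFDerivAt (fun w => ρ (φ.symm (φ (j w)))) (ContinuousLinearMap.id ℝ (Eu k)) w :=
        (hasFDerivAt_id w).congr_of_eventuallyEq
          (Filter.eventuallyEq_of_mem (hWo.mem_nhds hw) hinv)
      have h5 := h3.unique h4
      intro a b hab
      have ha := DFunLike.congr_fun h5 a
      have hb := DFunLike.congr_fun h5 b
      simp only [ContinuousLinearMap.comp_apply, ContinuousLinearMap.id_apply] at ha hb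
      rw [← ha, ← hb, hab]
    · let a : W → φ.target := fun w => ⟨φ (j w), φ.map_source w.2.2⟩
      let b : φ.target → Eu k := fun v => ρ (φ.symm v)
      have ha : Continuous a := Continuous.subtype_mk (hJ.continuousOn.domRestrict) _
      have hb : Continuous b := ρ.continuous.comp (φ.symm.continuousOn.domRestrict)
      have hba : Topology.IsEmbedding (b ∘ a) := by
        have : b ∘ a = Subtype.val := funext fun w => hinv w w.2
        rw [this]
        exact Topology.IsEmbedding.subtypeVal
      exact Topology.IsEmbedding.subtypeVal.comp (Topology.IsEmbedding.of_comp ha hb hba)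
    · intro w hw
      rw [hφ.map_eq _ hw.2, h.map_eq _ hw.1]
    · ext v
      constructor
      · rintro ⟨w, hw, rfl⟩
        refine ⟨⟨j w, ⟨h.mapsTo hw.1, hw.2⟩, rfl⟩, c.map w, ?_⟩
        rw [hφ.map_eq _ hw.2, h.map_eq _ hw.1]
      · rintro ⟨⟨z, hz, rfl⟩, hR⟩
        rw [mem_preimage, hφ.map_eq _ hz.2] at hR
        obtain ⟨h1, h2⟩ := h.right_inv z hz.1 hR
        refine ⟨ρ z, ⟨h1, ?_⟩, ?_⟩
        · rw [mem_preimage, h2]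
          exact hz.2
        · dsimp only
          rw [h2]
    · have hcont : ∀ γ : c.isotropy u, ∀ᶠ w in 𝓝 u, (γ : Eu k ≃L[ℝ] Eu k) w ∈ W := by
        intro γ
        refine (γ : Eu k ≃L[ℝ] Eu k).continuous.continuousAt.eventually ?_
        rw [γ.2.2]
        exact hcu
      refine exists_mulEquiv_of_relation
        (r := fun (γ : c.isotropy u) (γ' : d.isotropy (φ (j u))) =>
          ∀ᶠ w in 𝓝 u, φ (j ((γ : Eu k ≃L[ℝ] Eu k) w)) = (γ' : Eu n ≃L[ℝ] Eu n) (φ (j w)))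
        ?_ ?_ ?_ ?_ ?_
      · intro a b a' b' hab hab'
        have hcont' : Tendsto (fun w => (a' : Eu k ≃L[ℝ] Eu k) w) (𝓝 u) (𝓝 u) := by
          have := (a' : Eu k ≃L[ℝ] Eu k).continuous.tendsto u
          rwa [a'.2.2] at this
        filter_upwards [hab', hcont'.eventually hab] with w h1 h2
        change φ (j ((a : Eu k ≃L[ℝ] Eu k) ((a' : Eu k ≃L[ℝ] Eu k) w))) =
          (b : Eu n ≃L[ℝ] Eu n) ((b' : Eu n ≃L[ℝ] Eu n) (φ (j w)))
        rw [h2, h1]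
      · rintro ⟨γ, hγ, hγu⟩
        obtain ⟨γ₀, hγ₀, hγj⟩ := h.exists_lift γ hγ
        have h0 : γ₀ (j u) = j u := by rw [← hγj u hu, hγu]
        obtain ⟨γ', hγ', e'⟩ := hφ.exists_conj hs hγ₀ h0
        refine ⟨⟨γ', hγ', ?_⟩, ?_⟩
        · have := e'.self_of_nhds
          rw [h0] at this
          exact this.symm
        · filter_upwards [hju.eventually e', hcu] with w h1 h2
          rw [hγj w h2.1, h1]
      · rintro ⟨γ', hγ', hfix⟩
        obtain ⟨γ₀, hγ₀, γ, hγ, hγu, hγj, e₀⟩ := hback γ' hγ' hfix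
        refine ⟨⟨γ, hγ, hγu⟩, ?_⟩
        have ht : ∀ᶠ v in 𝓝 (φ (j u)), γ' v ∈ φ.target := by
          refine γ'.continuous.continuousAt.eventually ?_
          rw [hfix]
          exact φ.open_target.mem_nhds (φ.map_source hs)
        filter_upwards [hJu.eventually e₀, hJu.eventually ht, hcu] with w h1 h2 h3
        rw [φ.left_inv h3.2] at h1
        rw [hγj w h3.1, ← h1, φ.right_inv h2]
      · rintro a b b' hb hb'
        have h1 : (b : Eu n ≃L[ℝ] Eu n)⁻¹ * b' = 1 := by
          refine hfaith _ (d.group.mul_mem (d.group.inv_mem b.2.1) b'.2.1) ?_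
          filter_upwards [hb, hb'] with w h1 h2
          change (b : Eu n ≃L[ℝ] Eu n).symm ((b' : Eu n ≃L[ℝ] Eu n) (φ (j w))) = φ (j w)
          rw [← h2, h1, ContinuousLinearEquiv.symm_apply_apply]
        exact Subtype.ext (inv_mul_eq_one.1 h1)
      · intro a a' b ha ha'
        refine Subtype.ext (ContinuousLinearEquiv.eq_of_eventuallyEq (u := u) ?_)
        filter_upwards [ha, ha', hcont a, hcont a'] with w h1 h2 h3 h4
        exact hinj _ h3 _ h4 (h1.trans h2.symm)

open Classical in
/-- The restriction of a form on `M` to the suborbifold `Y`. -/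
def Form.restrict {p : ℕ} (σ : M.Form p) (hf : Function.Injective f)
    (hc : ∀ y : Y, ∃ c ∈ M.adaptedCharts f k, ∃ u ∈ c.domain, c.map u = y) :
    (M.suborbifold f hf hc).Form p where
  form c := if h : c ∈ M.adaptedCharts f k then fun w =>
      (σ.form h.choose (h.choose_spec.2.choose_spec.choose w)).compContinuousLinearMap
        (fderiv ℝ h.choose_spec.2.choose_spec.choose w)
    else 0
  contDiffOn := by
    intro c hcM
    have hcM' : c ∈ M.adaptedCharts f k := hcM
    rw [dif_pos hcM']
    obtain ⟨ρ, h⟩ := hcM'.choose_spec.2.choose_spec.choose_spec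
    exact (σ.contDiffOn _ hcM'.choose_spec.1).pullback_form c.isOpen_domain h.contDiffOn
      fun w hw => h.subset (h.mapsTo hw)
  pullback := by
    intro c hcM c' hcM' φ hφ u hu
    have h₁ : c ∈ M.adaptedCharts f k := hcM
    have h₂ : c' ∈ M.adaptedCharts f k := hcM'
    rw [dif_pos h₁, dif_pos h₂]
    obtain ⟨ρ, h⟩ := h₁.choose_spec.2.choose_spec.choose_spec
    obtain ⟨ρ', h'⟩ := h₂.choose_spec.2.choose_spec.choose_spec
    set j := h₁.choose_spec.2.choose_spec.choose
    set j' := h₂.choose_spec.2.choose_spec.choose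
    have h1 := σ.pullback_eq_of_lifts h₁.choose_spec.1 h₂.choose_spec.1 φ.open_source
      (f := j) (g := fun w => j' (φ w)) (h.contDiffOn.mono hφ.source_subset)
      (h'.contDiffOn.comp hφ.contDiffOn fun w hw => hφ.target_subset (φ.map_source hw))
      (fun w hw => h.subset (h.mapsTo (hφ.source_subset hw)))
      (fun w hw => h'.subset (h'.mapsTo (hφ.target_subset (φ.map_source hw))))
      (fun w hw => by
        rw [h.map_eq _ (hφ.source_subset hw), h'.map_eq _ (hφ.target_subset (φ.map_source hw)),
          hφ.map_eq _ hw]) hu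
    have hc : fderiv ℝ (fun w => j' (φ w)) u = (fderiv ℝ j' (φ u)).comp (fderiv ℝ φ u) :=
      fderiv_comp u ((h'.contDiffOn.contDiffAt (c'.isOpen_domain.mem_nhds
        (hφ.target_subset (φ.map_source hu)))).differentiableAt (by simp))
        ((hφ.contDiffOn.contDiffAt (φ.open_source.mem_nhds hu)).differentiableAt (by simp))
    rw [hc] at h1
    exact h1

variable {p : ℕ} (σ : M.Form p) (hf : Function.Injective f)
  (hc : ∀ y : Y, ∃ c ∈ M.adaptedCharts f k, ∃ u ∈ c.domain, c.map u = y)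

theorem Form.exists_restrict_eq {c : OrbifoldChart k Y} (h : c ∈ M.adaptedCharts f k) :
    ∃ d ∈ M.atlas, ∃ V j ρ, d.IsAdapted f c V j ρ ∧ (σ.restrict hf hc).form c =
      fun w => (σ.form d (j w)).compContinuousLinearMap (fderiv ℝ j w) := by
  obtain ⟨ρ, h'⟩ := h.choose_spec.2.choose_spec.choose_spec
  exact ⟨_, h.choose_spec.1, _, _, ρ, h', dif_pos h⟩

theorem Form.restrict_isPullback : (σ.restrict hf hc).IsPullback f σ := by
  intro c hcM d hd W J hW hWc hJ hJd w hw
  obtain ⟨d₀, hd₀, V, j, ρ, h, e⟩ := σ.exists_restrict_eq hf hc hcM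
  rw [e]
  exact σ.pullback_eq_of_lifts hd₀ hd hW (h.contDiffOn.mono hWc) hJ
    (fun w hw => h.subset (h.mapsTo (hWc hw))) (fun w hw => (hJd w hw).1)
    (fun w hw => by rw [h.map_eq _ (hWc hw), (hJd w hw).2]) hw

theorem Form.restrict_isSymplectic {σ : M.Form 2} (hσ : M.IsSymplectic σ) {q : ℕ}
    (hn : Nonempty Y → k + q = n)
    (hmodel : ∀ d ∈ M.atlas, ∀ z ∈ d.domain, d.map z ∈ range f →
      ∃ (F : Eu n → Fin q → ℝ) (T : (Fin q → ℝ) →L[ℝ] Eu n), d.IsLocalModel (range f) z F T ∧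
        ∀ e v, fderiv ℝ F z v = 0 → σ.form d z ![T e, v] = 0) :
    (M.suborbifold f hf hc).IsSymplectic (σ.restrict hf hc) where
  closed := by
    intro c hcM u hu
    obtain ⟨d, hd, V, j, ρ, h, e⟩ := σ.exists_restrict_eq hf hc hcM
    have hju : j u ∈ d.domain := h.subset (h.mapsTo hu)
    rw [e, extDeriv_pullback (r := ∞) (((σ.contDiffOn d hd).contDiffAt
      (d.isOpen_domain.mem_nhds hju)).differentiableAt (by simp))
      (h.contDiffOn.contDiffAt (c.isOpen_domain.mem_nhds hu))
      (by rw [minSmoothness_of_isRCLikeNormedField]; exact ENat.LEInfty.out), hσ.closed d hd _ hju]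
    rfl
  nondegenerate := by
    intro c hcM u hu v hv
    obtain ⟨d, hd, V, j, ρ, h, e⟩ := σ.exists_restrict_eq hf hc hcM
    have hju : j u ∈ d.domain := h.subset (h.mapsTo hu)
    have hn' := hn ⟨c.map u⟩
    obtain ⟨F, T, hF, hT⟩ := hmodel d hd (j u) hju ⟨_, (h.map_eq u hu).symm⟩
    set D : Eu n →L[ℝ] Fin q → ℝ := fderiv ℝ F (j u) with hD
    set B : Eu k →L[ℝ] Eu n := fderiv ℝ j u with hB
    have hjd : HasFDerivAt j B u :=
      ((h.contDiffOn.contDiffAt (c.isOpen_domain.mem_nhds hu)).differentiableAt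
        (by simp)).hasFDerivAt
    have hFd : HasFDerivAt F D (j u) :=
      ((hF.contDiffOn.contDiffAt (d.isOpen_domain.mem_nhds hju)).differentiableAt
        (by simp)).hasFDerivAt
    have hρB : ρ.comp B = ContinuousLinearMap.id ℝ (Eu k) := by
      refine (ρ.hasFDerivAt.comp u hjd).unique ((hasFDerivAt_id u).congr_of_eventuallyEq ?_)
      exact Filter.eventuallyEq_of_mem (c.isOpen_domain.mem_nhds hu) h.left_inv
    have hDB : D.comp B = 0 := by
      refine (hFd.comp u hjd).unique
        ((hasFDerivAt_const (0 : Fin q → ℝ) u).congr_of_eventuallyEq ?_)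
      filter_upwards [hjd.continuousAt.eventually hF.eventually_iff,
        c.isOpen_domain.mem_nhds hu] with w h1 h2
      exact h1.1 ⟨_, (h.map_eq w h2).symm⟩
    have hBinj : Function.Injective B := fun a b hab => by
      have ha := DFunLike.congr_fun hρB a
      have hb := DFunLike.congr_fun hρB b
      simp only [ContinuousLinearMap.comp_apply, ContinuousLinearMap.id_apply] at ha hb
      rw [← ha, ← hb, hab]
    have hrange : LinearMap.range B.toLinearMap = LinearMap.ker D.toLinearMap := by
      apply Submodule.eq_of_le_of_finrank_eq
      · rintro _ ⟨w, rfl⟩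
        exact DFunLike.congr_fun hDB w
      · have h1 := LinearMap.finrank_range_of_inj (f := B.toLinearMap) hBinj
        have h2 := LinearMap.finrank_range_add_finrank_ker D.toLinearMap
        have h3 : LinearMap.range D.toLinearMap = ⊤ := by
          rw [LinearMap.range_eq_top]
          intro a
          obtain ⟨b, hb⟩ := hF.bijective.2 a
          exact ⟨T b, hb⟩
        rw [h3, finrank_top, Module.finrank_fintype_fun_eq_card, Fintype.card_fin,
          finrank_euclideanSpace, Fintype.card_fin] at h2
        rw [finrank_euclideanSpace, Fintype.card_fin] at h1
        omega
    have hBv : B v = 0 := by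
      refine hσ.nondegenerate d hd (j u) hju (B v) fun b => ?_
      obtain ⟨t, ht⟩ := hF.bijective.2 (D b)
      have ht' : D (T t) = D b := ht
      have hb : b - T t ∈ LinearMap.range B.toLinearMap := by
        rw [hrange]
        change D (b - T t) = 0
        rw [map_sub, ht', sub_self]
      obtain ⟨w, hw⟩ := hb
      have hw' : B w = b - T t := hw
      have h1 : σ.form d (j u) ![B v, B w] = 0 := by
        have := hv w
        rw [e] at this
        refine Eq.trans ?_ this
        change _ = σ.form d (j u) (B ∘ ![v, w])
        congr 1
        ext i : 1
        fin_cases i <;> rfl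
      have h2 : σ.form d (j u) ![B v, T t] = 0 := by
        rw [(σ.form d (j u)).apply_pair_swap, hT t (B v) (DFunLike.congr_fun hDB v), neg_zero]
      have h5 : b = B w + T t := by rw [hw', sub_add_cancel]
      rw [h5, (σ.form d (j u)).apply_pair_add, h1, h2, add_zero]
    exact hBinj (by rw [hBv, map_zero])

end Orbifold

end Suborbifold

/-! ### Curves in Lie groups and induced vectors -/

section Curves

variable {E : Type*} [NormedAddCommGroup E] [NormedSpace ℝ E]
  {H : Type*} [TopologicalSpace H] (I : ModelWithCorners ℝ E H)
  {G : Type*} [TopologicalSpace G] [ChartedSpace H G] [Group G]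
  {W : Type*} [NormedAddCommGroup W] [NormedSpace ℝ W]

variable {I} in
theorem hasDerivAt_comp_curve {Ψ : G → W} {L : E →L[ℝ] W} (hΨ : HasMFDerivAt I 𝓘(ℝ, W) Ψ 1 L)
    {c : ℝ → G} (h0 : c 0 = 1) (hc : MDifferentiableAt 𝓘(ℝ, ℝ) I c 0) :
    HasDerivAt (fun t => Ψ (c t)) (L (velocity I c)) 0 := by
  have aux : ∀ q : G, q = 1 → HasMFDerivAt I 𝓘(ℝ, W) Ψ q L := by
    rintro q rfl
    exact hΨ
  have h1 := HasMFDerivAt.comp (0 : ℝ) (aux (c 0) h0) hc.hasMFDerivAt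
  have h2 : HasFDerivAt (fun t => Ψ (c t)) (L.comp (mfderiv 𝓘(ℝ, ℝ) I c 0 : ℝ →L[ℝ] E)) 0 :=
    h1.hasFDerivAt
  exact h2.hasDerivAt

variable [I.Boundaryless] [LieGroup I ∞ G]

/-- A smooth family of group elements through the identity with given derivative. -/
theorem exists_local_parametrization {V : Type*} [NormedAddCommGroup V] [NormedSpace ℝ V]
    (L : V →L[ℝ] E) :
    ∃ κ : V → G, κ 0 = 1 ∧ ContMDiffAt 𝓘(ℝ, V) I ∞ κ 0 ∧
      ∀ e : V, velocity I (fun t : ℝ => κ (t • e)) = L e := by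
  let b := extChartAt I (1 : G) 1
  let s : E → G := (extChartAt I (1 : G)).symm
  have hs : ContMDiffAt 𝓘(ℝ, E) I ∞ s b := by
    have := contMDiffWithinAt_extChartAt_symm_range_self (I := I) (n := ∞) (1 : G)
    rwa [I.range_eq_univ, contMDiffWithinAt_univ] at this
  have hsb : s b = 1 := extChartAt_to_inv (1 : G)
  have hs' : mfderiv 𝓘(ℝ, E) I s b = ContinuousLinearMap.id ℝ E := by
    have := mfderivWithin_range_extChartAt_symm (I := I) (x := (1 : G))
    rwa [I.range_eq_univ, mfderivWithin_univ] at this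
  have hsd : ∀ q : E, q = b → HasMFDerivAt 𝓘(ℝ, E) I s q (ContinuousLinearMap.id ℝ E) := by
    rintro q rfl
    have := (hs.mdifferentiableAt (by simp)).hasMFDerivAt
    rwa [hs'] at this
  have haff : ContDiff ℝ ∞ (fun e : V => b + L e) := contDiff_const.add L.contDiff
  refine ⟨fun e => s (b + L e), by simp [hsb], ?_, fun e => ?_⟩
  · have h1 : ContMDiffAt 𝓘(ℝ, V) 𝓘(ℝ, E) ∞ (fun e : V => b + L e) 0 :=
      haff.contMDiff.contMDiffAt
    refine ContMDiffAt.comp (0 : V) (g := s) ?_ h1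
    simpa using hs
  · have h2 : HasFDerivAt (fun t : ℝ => b + L (t • e))
        ((ContinuousLinearMap.id ℝ ℝ).smulRight (L e)) 0 := by
      have h3 := ((hasFDerivAt_id (𝕜 := ℝ) (0 : ℝ)).smul_const (L e)).const_add b
      have h4 : (fun t : ℝ => b + L (t • e)) = fun t : ℝ => b + id t • L e := by
        ext1 t
        rw [map_smul]
        rfl
      rw [h4]
      exact h3
    have h5 := HasMFDerivAt.comp (0 : ℝ) (hsd (b + L ((0 : ℝ) • e)) (by simp)) h2.hasMFDerivAt
    refine (congrArg (fun L : ℝ →L[ℝ] E => L 1) h5.mfderiv).trans ?_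
    change (1 : ℝ) • L e = L e
    rw [one_smul]

variable [FiniteDimensional ℝ E]

/-- A local one-parameter curve with given velocity: all its left translates have the same
velocity. -/
theorem exists_curve_translates (ξ : GroupLieAlgebra I G) :
    ∃ c : ℝ → G, c 0 = 1 ∧ MDifferentiableAt 𝓘(ℝ, ℝ) I c 0 ∧ velocity I c = ξ ∧
      ∀ᶠ t in 𝓝 (0 : ℝ), MDifferentiableAt 𝓘(ℝ, ℝ) I (fun s => (c t)⁻¹ * c (t + s)) 0 ∧
        velocity I (fun s => (c t)⁻¹ * c (t + s)) = ξ := by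
  have : CompleteSpace E := FiniteDimensional.complete ℝ E
  have : LieGroup I (minSmoothness ℝ 3) G := LieGroup.of_le (n := ∞) (by
    rw [minSmoothness_of_isRCLikeNormedField]; exact ENat.LEInfty.out)
  have : IsManifold I 1 G := IsManifold.of_le (n := ∞) ENat.LEInfty.out
  obtain ⟨c, hc0, hc⟩ := exists_isMIntegralCurveAt_of_contMDiffAt_boundaryless (I := I) (M := G)
    (v := mulInvariantVectorField ξ) (x₀ := 1) 0
    ((contMDiffAt_mulInvariantVectorField ξ).of_le (by
      rw [minSmoothness_of_isRCLikeNormedField]; exact one_le_two))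
  have h0 := hc.self_of_nhds
  have hvel : ∀ (g : G), g = 1 → (mulInvariantVectorField ξ g : E) = ξ := by
    rintro g rfl
    have e : (fun h : G => 1 * h) = id := by
      ext h
      simp
    have e' : mfderiv I I (fun h : G => 1 * h) 1 = ContinuousLinearMap.id ℝ _ := by
      rw [e]
      exact mfderiv_id
    exact congrArg (fun L : E →L[ℝ] E => L ξ) e'
  have hsmul : ∀ v : E, ((1 : ℝ →L[ℝ] ℝ).smulRight v) (1 : ℝ) = v := fun v => by simp
  refine ⟨c, hc0, h0.mdifferentiableAt, ?_, ?_⟩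
  · unfold velocity
    rw [h0.mfderiv]
    exact (hsmul _).trans (hvel _ hc0)
  · filter_upwards [hc] with t ht
    have h1 : HasMFDerivAt 𝓘(ℝ, ℝ) 𝓘(ℝ, ℝ) (fun s : ℝ => t + s) 0
        (ContinuousLinearMap.id ℝ ℝ) := ((hasFDerivAt_id (0 : ℝ)).const_add t).hasMFDerivAt
    have aux : ∀ q : ℝ, q = t → HasMFDerivAt 𝓘(ℝ, ℝ) I c q
        ((1 : ℝ →L[ℝ] ℝ).smulRight (mulInvariantVectorField ξ (c t) : E)) := by
      rintro q rfl
      exact ht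
    have h2 := HasMFDerivAt.comp (0 : ℝ) (aux (t + 0) (add_zero t)) h1
    have hL : MDifferentiableAt I I (fun h : G => (c t)⁻¹ * h) (c (t + 0)) :=
      (contMDiff_mul_left (I := I) (n := ∞) (a := (c t)⁻¹)).mdifferentiable (by simp) _
    have h3 := HasMFDerivAt.comp (0 : ℝ) hL.hasMFDerivAt h2
    have hinv : ∀ g : G, ∀ q : G, q = g → (mfderiv I I (fun h : G => g⁻¹ * h) q : E →L[ℝ] E)
        (mulInvariantVectorField ξ g : E) = ξ := by
      rintro g q rfl
      have hd1 : MDifferentiableAt I I (fun h : G => q⁻¹ * h) (q * 1) :=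
        (contMDiff_mul_left (I := I) (n := ∞) (a := q⁻¹)).mdifferentiable (by simp) _
      have hd2 : MDifferentiableAt I I (fun h : G => q * h) 1 :=
        (contMDiff_mul_left (I := I) (n := ∞) (a := q)).mdifferentiable (by simp) _
      have hcomp := mfderiv_comp (I := I) (I' := I) (I'' := I) (1 : G) hd1 hd2
      have e : (fun h : G => q⁻¹ * h) ∘ (fun h : G => q * h) = id := by
        ext h
        simp
      rw [e] at hcomp
      have h5 : (mfderiv I I (fun h : G => q⁻¹ * h) (q * 1) : E →L[ℝ] E)
          (mulInvariantVectorField ξ q : E) = ξ :=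
        (congrArg (fun L : E →L[ℝ] E => L ξ) hcomp).symm.trans
          (congrArg (fun L : E →L[ℝ] E => L ξ) (mfderiv_id (I := I) (x := (1 : G))))
      have aux' : ∀ q' : G, q' = q → (mfderiv I I (fun h : G => q⁻¹ * h) q' : E →L[ℝ] E) =
          (mfderiv I I (fun h : G => q⁻¹ * h) q : E →L[ℝ] E) := by
        rintro q' rfl
        rfl
      rw [aux' (q * 1) (mul_one q)] at h5
      exact h5
    refine ⟨h3.mdifferentiableAt, ?_⟩
    have h4 : velocity I (fun s => (c t)⁻¹ * c (t + s)) =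
        (mfderiv I I (fun h : G => (c t)⁻¹ * h) (c (t + 0)) : E →L[ℝ] E)
          (((1 : ℝ →L[ℝ] ℝ).smulRight (mulInvariantVectorField ξ (c t) : E)) (1 : ℝ)) :=
      congrArg (fun L : ℝ →L[ℝ] E => L 1) h3.mfderiv
    exact h4.trans ((congrArg (mfderiv I I (fun h : G => (c t)⁻¹ * h) (c (t + 0)) : E →L[ℝ] E)
      (hsmul _)).trans (hinv (c t) _ (by rw [add_zero])))

theorem lieAlgebraOf_top : lieAlgebraOf I (⊤ : Subgroup G) = ⊤ := by
  rw [eq_top_iff]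
  intro ξ _
  obtain ⟨c, h0, hc, hv, -⟩ := exists_curve_translates I ξ
  exact ⟨c, h0, fun _ => trivial, hc, hv⟩

end Curves

/-! ### Local lifts of actions and induced vector fields -/

section InducedVectors

variable {E : Type*} [NormedAddCommGroup E] [NormedSpace ℝ E]
  {H : Type*} [TopologicalSpace H] {I : ModelWithCorners ℝ E H}
  {G : Type*} [TopologicalSpace G] [ChartedSpace H G] [Group G]
  {n : ℕ} {X : Type*} [TopologicalSpace X]

section Lift

variable {K : Subgroup G} [MulAction K X] {c d : OrbifoldChart n X} {O : Set (G × Eu n)}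
  {a : G × Eu n → Eu n}

theorem IsActionLift.isOpen_slice (hL : IsActionLift I K c d O a) (g : G) :
    IsOpen {u | (g, u) ∈ O} :=
  hL.isOpen.preimage (by fun_prop)

theorem IsActionLift.contDiffOn_slice (hL : IsActionLift I K c d O a) (g : G) :
    ContDiffOn ℝ ∞ (fun u => a (g, u)) {u | (g, u) ∈ O} := by
  rw [← contMDiffOn_iff_contDiffOn]
  exact hL.contMDiffOn.comp ((contMDiff_const.prodMk contMDiff_id).contMDiffOn) fun u hu => hu

theorem IsActionLift.mono {O' : Set (G × Eu n)} (hL : IsActionLift I K c d O a) (hO' : IsOpen O')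
    (h : O' ⊆ O) : IsActionLift I K c d O' a :=
  ⟨hO', fun q hq => hL.mem_domain q (h hq), fun q hq => hL.apply_mem q (h hq),
    hL.contMDiffOn.mono h, fun k u hq => hL.map_eq k u (h hq)⟩

theorem IsActionLift.hasMFDerivAt (hL : IsActionLift I K c d O a) {u : Eu n}
    (hu : ((1 : G), u) ∈ O) :
    HasMFDerivAt I 𝓘(ℝ, Eu n) (fun g => a (g, u)) 1
      (mfderiv I 𝓘(ℝ, Eu n) (fun g => a (g, u)) 1 : E →L[ℝ] Eu n) := by
  have h1 : ContMDiffAt (I.prod 𝓘(ℝ, Eu n)) 𝓘(ℝ, Eu n) ∞ a ((1 : G), u) :=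
    hL.contMDiffOn.contMDiffAt (hL.isOpen.mem_nhds hu)
  have h2 : ContMDiffAt I 𝓘(ℝ, Eu n) ∞ (fun g => a (g, u)) 1 :=
    ContMDiffAt.comp (1 : G) (g := a) (f := fun g : G => (g, u)) h1
      (contMDiffAt_id.prodMk contMDiffAt_const)
  exact (h2.mdifferentiableAt (by simp)).hasMFDerivAt

theorem IsActionLift.hasDerivAt_curve (hL : IsActionLift I K c d O a) {u : Eu n}
    (hu : ((1 : G), u) ∈ O) {γ : ℝ → G} (h0 : γ 0 = 1)
    (hγ : MDifferentiableAt 𝓘(ℝ, ℝ) I γ 0) :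
    HasDerivAt (fun t => a (γ t, u)) (Orbifold.inducedVector I a (velocity I γ : E) u) 0 :=
  hasDerivAt_comp_curve (hL.hasMFDerivAt hu) h0 hγ

theorem IsActionLift.eventually_mem (hL : IsActionLift I K c d O a) {u : Eu n}
    (hu : ((1 : G), u) ∈ O) {γ : ℝ → G} (h0 : γ 0 = 1)
    (hγ : MDifferentiableAt 𝓘(ℝ, ℝ) I γ 0) : ∀ᶠ t in 𝓝 (0 : ℝ), (γ t, u) ∈ O := by
  have hc : ContinuousAt (fun t => (γ t, u)) 0 := hγ.continuousAt.prodMk continuousAt_const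
  refine hc.eventually (hL.isOpen.mem_nhds ?_)
  change (γ 0, u) ∈ O
  rw [h0]
  exact hu

end Lift

variable [MulAction G X] {M : Orbifold n X}

theorem Orbifold.IsSmoothAction.exists_lift_one (hsmooth : M.IsSmoothAction I (⊤ : Subgroup G))
    {d : OrbifoldChart n X} (hd : d ∈ M.atlas) {z : Eu n} (hz : z ∈ d.domain) :
    ∃ O a, IsActionLift I (⊤ : Subgroup G) d d O a ∧ ((1 : G), z) ∈ O ∧
      ∀ u, ((1 : G), u) ∈ O → a (1, u) = u := by
  obtain ⟨O, a, hL, hzO, ha⟩ := hsmooth d hd d hd 1 z hz z hz (one_smul _ _).symm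
  have hzO' : ((1 : G), z) ∈ O := hzO
  have ha' : a ((1 : G), z) = z := ha
  obtain ⟨γ, hγ, hev⟩ := d.exists_eventuallyEq_of_map_eq (h := fun u => a ((1 : G), u))
    (hL.isOpen_slice 1) hzO' (fun u hu => hL.mem_domain _ hu)
    ((hL.contDiffOn_slice 1).of_le (by simp)) (fun u hu => hL.apply_mem _ hu)
    (fun u hu => (hL.map_eq 1 u hu).trans (one_smul _ _))
  obtain ⟨N, hN, hNo, hzN⟩ := mem_nhds_iff.1 hev
  refine ⟨O ∩ Prod.snd ⁻¹' N, fun q => γ.symm (a q), ?_, ⟨hzO', hzN⟩, ?_⟩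
  · have hL' := hL.mono (hL.isOpen.inter (hNo.preimage continuous_snd)) inter_subset_left
    refine ⟨hL'.isOpen, hL'.mem_domain, fun q hq => ?_, ?_, fun k u hq => ?_⟩
    · exact d.apply_mem γ⁻¹ (d.group.inv_mem hγ) _ (hL'.apply_mem q hq)
    · exact γ.symm.contDiff.contMDiff.comp_contMDiffOn hL'.contMDiffOn
    · rw [← hL'.map_eq k u hq]
      exact d.map_apply (d.group.inv_mem hγ) (hL'.apply_mem _ hq)
  · rintro u ⟨-, hu⟩
    have : a ((1 : G), u) = γ u := hN hu
    dsimp only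
    rw [this, ContinuousLinearEquiv.symm_apply_apply]

variable [LieGroup I ∞ G] [FiniteDimensional ℝ E] [I.Boundaryless]
  {σ : M.Form 2} {Φ : X → LieDual I G}

namespace Orbifold.IsMomentMap

theorem map_smul (hΦ : M.IsMomentMap I (⊤ : Subgroup G) σ Φ)
    (g : G) (p : X) : Φ (g • p) = coad I g (Φ p) := by
  refine ContinuousLinearMap.ext fun ξ => ?_
  exact hΦ.equivariant ⟨g, trivial⟩ p ξ (by rw [lieAlgebraOf_top]; trivial)

theorem contDiffOn' (hΦ : M.IsMomentMap I (⊤ : Subgroup G) σ Φ)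
    {d : OrbifoldChart n X} (hd : d ∈ M.atlas) (ξ : GroupLieAlgebra I G) :
    ContDiffOn ℝ ∞ (fun u => Φ (d.map u) ξ) d.domain :=
  hΦ.contDiffOn d hd ξ (by rw [lieAlgebraOf_top]; trivial)

theorem hasFDerivAt (hΦ : M.IsMomentMap I (⊤ : Subgroup G) σ Φ)
    {d : OrbifoldChart n X} (hd : d ∈ M.atlas) (ξ : GroupLieAlgebra I G)
    {u : Eu n} (hu : u ∈ d.domain) :
    HasFDerivAt (fun u => Φ (d.map u) ξ) (fderiv ℝ (fun u => Φ (d.map u) ξ) u) u :=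
  (((hΦ.contDiffOn' hd ξ).contDiffAt (d.isOpen_domain.mem_nhds hu)).differentiableAt
    (by simp)).hasFDerivAt

theorem contraction (hΦ : M.IsMomentMap I (⊤ : Subgroup G) σ Φ)
    {d : OrbifoldChart n X} (hd : d ∈ M.atlas)
    {O : Set (G × Eu n)} {a : G × Eu n → Eu n} (hL : IsActionLift I (⊤ : Subgroup G) d d O a)
    (ha : ∀ u, ((1 : G), u) ∈ O → a (1, u) = u) {z : Eu n} (hz : ((1 : G), z) ∈ O)
    (ξ : GroupLieAlgebra I G) (w : Eu n) :
    σ.form d z ![inducedVector I a ξ z, w] = - fderiv ℝ (fun u => Φ (d.map u) ξ) z w :=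
  hΦ.contraction_eq d hd O a hL ha z hz ξ (by rw [lieAlgebraOf_top]; trivial) w

theorem hasDerivAt_curve (hΦ : M.IsMomentMap I (⊤ : Subgroup G) σ Φ)
    {d : OrbifoldChart n X} (hd : d ∈ M.atlas)
    {O : Set (G × Eu n)} {a : G × Eu n → Eu n} (hL : IsActionLift I (⊤ : Subgroup G) d d O a)
    (ha : ∀ u, ((1 : G), u) ∈ O → a (1, u) = u) {z : Eu n} (hz : ((1 : G), z) ∈ O)
    {γ : ℝ → G} (h0 : γ 0 = 1) (hγ : MDifferentiableAt 𝓘(ℝ, ℝ) I γ 0)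
    (η : GroupLieAlgebra I G) :
    HasDerivAt (fun t => Φ (γ t • d.map z) η) (fderiv ℝ (fun u => Φ (d.map u) η) z
      (inducedVector I a (velocity I γ : E) z)) 0 := by
  have hzd : z ∈ d.domain := hL.mem_domain _ hz
  have h1 := hL.hasDerivAt_curve hz h0 hγ
  have h2 : HasFDerivAt (fun u => Φ (d.map u) η) (fderiv ℝ (fun u => Φ (d.map u) η) z)
      (a (γ 0, z)) := by
    rw [h0, ha z hz]
    exact hΦ.hasFDerivAt hd η hzd
  refine (h2.comp_hasDerivAt (0 : ℝ) h1).congr_of_eventuallyEq ?_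
  filter_upwards [hL.eventually_mem hz h0 hγ] with t ht
  have := hL.map_eq ⟨γ t, trivial⟩ z ht
  change Φ (γ t • d.map z) η = Φ (d.map (a (γ t, z))) η
  rw [this]
  rfl

/-- Induced vectors are invariant under the isotropy group. -/
theorem apply_inducedVector (hΦ : M.IsMomentMap I (⊤ : Subgroup G) σ Φ)
    {d : OrbifoldChart n X} (hd : d ∈ M.atlas)
    {O : Set (G × Eu n)} {a : G × Eu n → Eu n} (hL : IsActionLift I (⊤ : Subgroup G) d d O a)
    (ha : ∀ u, ((1 : G), u) ∈ O → a (1, u) = u) {z : Eu n} (hz : ((1 : G), z) ∈ O)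
    (hσ : M.IsSymplectic σ) {γ : Eu n ≃L[ℝ] Eu n} (hγ : γ ∈ d.group)
    (hγz : γ z = z) (ξ : GroupLieAlgebra I G) :
    γ (inducedVector I a ξ z) = inducedVector I a ξ z := by
  have hzd : z ∈ d.domain := hL.mem_domain _ hz
  refine sub_eq_zero.1 (hσ.nondegenerate d hd z hzd _ fun w => ?_)
  set v := inducedVector I a ξ z with hv
  have h1 : σ.form d z ![γ v, w] = σ.form d z ![v, γ.symm w] := by
    conv_rhs => rw [σ.invariant hd hγ hzd, hγz]
    change _ = σ.form d z (γ ∘ ![v, γ.symm w])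
    congr 1
    ext i : 1
    fin_cases i
    · rfl
    · exact (γ.apply_symm_apply w).symm
  have h2 : fderiv ℝ (fun u => Φ (d.map u) ξ) z (γ.symm w) =
      fderiv ℝ (fun u => Φ (d.map u) ξ) z w := by
    have h3 : HasFDerivAt (fun u => Φ (d.map u) ξ) (fderiv ℝ (fun u => Φ (d.map u) ξ) z)
        (γ z) := by
      rw [hγz]
      exact hΦ.hasFDerivAt hd ξ hzd
    have h4 := h3.comp z γ.hasFDerivAt
    have h5 := h4.congr_of_eventuallyEq (f₁ := fun u => Φ (d.map u) ξ)
      (Filter.eventuallyEq_of_mem (d.isOpen_domain.mem_nhds hzd) fun u hu => by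
        change _ = Φ (d.map (γ u)) ξ
        rw [d.map_apply hγ hu])
    have h6 := DFunLike.congr_fun (h5.unique (hΦ.hasFDerivAt hd ξ hzd)) (γ.symm w)
    refine h6.symm.trans ?_
    exact congrArg _ (γ.apply_symm_apply w)
  have h7 : σ.form d z ![γ v, w] = σ.form d z ![v, w] := by
    rw [h1, hv, hΦ.contraction hd hL ha hz, hΦ.contraction hd hL ha hz, h2]
  have h8 : γ v = (γ v - v) + v := by rw [sub_add_cancel]
  rw [(σ.form d z).apply_pair_swap, neg_eq_zero]
  rw [(σ.form d z).apply_pair_swap (γ v) w, (σ.form d z).apply_pair_swap v w, neg_inj, h8,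
    (σ.form d z).apply_pair_add] at h7
  linarith

/-- If all components of the moment map have vanishing derivative in the direction induced by `ξ`,
then `ξ` belongs to the isotropy algebra of the value of the moment map. -/
theorem mem_lieAlgebraOf_coadStabilizer (hΦ : M.IsMomentMap I (⊤ : Subgroup G) σ Φ)
    {d : OrbifoldChart n X} (hd : d ∈ M.atlas)
    {O : Set (G × Eu n)} {a : G × Eu n → Eu n} (hL : IsActionLift I (⊤ : Subgroup G) d d O a)
    (ha : ∀ u, ((1 : G), u) ∈ O → a (1, u) = u) {z : Eu n} (hz : ((1 : G), z) ∈ O)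
    {ξ : GroupLieAlgebra I G}
    (hξ : ∀ η, fderiv ℝ (fun u => Φ (d.map u) η) z (inducedVector I a ξ z) = 0) :
    ξ ∈ lieAlgebraOf I (coadStabilizer I (Φ (d.map z))) := by
  obtain ⟨c, hc0, hcd, hcv, hev⟩ := exists_curve_translates I ξ
  obtain ⟨ε, hε, hball⟩ := Metric.eventually_nhds_iff_ball.1 hev
  have hder : ∀ t ∈ Metric.ball (0 : ℝ) ε, ∀ η,
      HasDerivAt (fun t => Φ (c t • d.map z) η) 0 t := by
    intro t ht η
    obtain ⟨hed, hevel⟩ := hball t ht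
    have h1 := hΦ.hasDerivAt_curve hd hL ha hz (γ := fun s => (c t)⁻¹ * c (t + s)) (by simp) hed
      (Ad I (c t)⁻¹ η)
    have hvel : velocity I (fun s => (c t)⁻¹ * c (t + s)) = ξ := hevel
    rw [hvel, hξ] at h1
    have h2 : (fun s => Φ (c (t + s) • d.map z) η) =
        fun s => Φ (((c t)⁻¹ * c (t + s)) • d.map z) (Ad I (c t)⁻¹ η) := by
      ext1 s
      have h3 : c (t + s) • d.map z = c t • (((c t)⁻¹ * c (t + s)) • d.map z) := by
        rw [← mul_smul, mul_inv_cancel_left]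
      rw [h3, hΦ.map_smul (c t)]
      rfl
    rw [← h2] at h1
    have h4 : HasDerivAt (fun s => Φ (c (t + s) • d.map z) η) 0 (t - t) := by rwa [sub_self]
    have h5 := HasDerivAt.comp_sub_const t t h4
    simpa using h5
  have hconst : ∀ t ∈ Metric.ball (0 : ℝ) ε, coad I (c t) (Φ (d.map z)) = Φ (d.map z) := by
    intro t ht
    rw [← hΦ.map_smul]
    refine ContinuousLinearMap.ext fun η => ?_
    have := Metric.isOpen_ball.is_const_of_deriv_eq_zero (𝕜 := ℝ)
      (f := fun t => Φ (c t • d.map z) η) (convex_ball (0 : ℝ) ε).isPreconnected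
      (fun s hs => (hder s hs η).differentiableAt.differentiableWithinAt)
      (fun s hs => (hder s hs η).deriv) ht (Metric.mem_ball_self hε)
    simpa [hc0] using this
  classical
  let c' : ℝ → G := fun t => if t ∈ Metric.ball (0 : ℝ) ε then c t else 1
  have hcc' : c' =ᶠ[𝓝 0] c :=
    Filter.eventuallyEq_of_mem (Metric.ball_mem_nhds 0 hε) fun t ht => if_pos ht
  refine ⟨c', ?_, fun t => ?_, ?_, ?_⟩
  · rw [hcc'.self_of_nhds, hc0]
  · by_cases ht : t ∈ Metric.ball (0 : ℝ) ε
    · simp only [c', if_pos ht]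
      exact hconst t ht
    · simp only [c', if_neg ht]
      exact Subgroup.one_mem _
  · exact hcd.congr_of_eventuallyEq hcc'
  · refine Eq.trans ?_ hcv
    have h1 := (hcd.hasMFDerivAt.congr_of_eventuallyEq hcc').mfderiv
    exact congrArg (fun L : ℝ →L[ℝ] E => L 1) h1

end Orbifold.IsMomentMap

end InducedVectors

/-! ### The preimage of the natural slice -/

section CrossSection

theorem ContinuousAlternatingMap.exists_pairLeft {V : Type*} [NormedAddCommGroup V]
    [NormedSpace ℝ V] (A : V [⋀^Fin 2]→L[ℝ] ℝ) (w : V) :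
    ∃ l : V →ₗ[ℝ] ℝ, ∀ v, l v = A ![v, w] := by
  refine ⟨A.toMultilinearMap.toLinearMap ![0, w] 0, fun v => ?_⟩
  change A (Function.update ![0, w] 0 v) = _
  congr 1
  ext i : 1
  fin_cases i <;> rfl

theorem lieAlgebraOf_mono {E : Type*} [NormedAddCommGroup E] [NormedSpace ℝ E]
    {H : Type*} [TopologicalSpace H] {I : ModelWithCorners ℝ E H}
    {G : Type*} [TopologicalSpace G] [ChartedSpace H G] [Group G] [LieGroup I ∞ G]
    {K K' : Subgroup G} (h : K ≤ K') :
    lieAlgebraOf I K ≤ lieAlgebraOf I K' := by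
  rintro ξ ⟨c, h0, hK, hc, hv⟩
  exact ⟨c, h0, fun t => h (hK t), hc, hv⟩

variable {E : Type*} [NormedAddCommGroup E] [NormedSpace ℝ E] [FiniteDimensional ℝ E]
  {H : Type*} [TopologicalSpace H] {I : ModelWithCorners ℝ E H} [I.Boundaryless]
  {G : Type*} [TopologicalSpace G] [ChartedSpace H G] [Group G] [LieGroup I ∞ G]
  {n : ℕ} {X : Type*} [TopologicalSpace X] [MulAction G X]
  {M : Orbifold n X} {σ : M.Form 2} {Φ : X → LieDual I G}

namespace Orbifold.IsMomentMap

theorem continuousOn (hΦ : M.IsMomentMap I (⊤ : Subgroup G) σ Φ) {d : OrbifoldChart n X}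
    (hd : d ∈ M.atlas) : ContinuousOn (fun u => Φ (d.map u)) d.domain := by
  let f : Eu n → E →L[ℝ] ℝ := fun u => Φ (d.map u)
  have h : ContinuousOn f d.domain :=
    continuousOn_clm_apply.2 fun ξ => (hΦ.contDiffOn' hd ξ).continuousOn
  exact h

theorem fderiv_inducedVector_eq_zero (hΦ : M.IsMomentMap I (⊤ : Subgroup G) σ Φ)
    {d : OrbifoldChart n X} (hd : d ∈ M.atlas)
    {O : Set (G × Eu n)} {a : G × Eu n → Eu n} (hL : IsActionLift I (⊤ : Subgroup G) d d O a)
    (ha : ∀ u, ((1 : G), u) ∈ O → a (1, u) = u) {z : Eu n} (hz : ((1 : G), z) ∈ O)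
    {x : LieDual I G} {m : Submodule ℝ (GroupLieAlgebra I G)} (hm : IsInvariantComplement I x m)
    (hy : ∀ ξ ∈ m, Φ (d.map z) ξ = 0) {ξ η : GroupLieAlgebra I G} (hξ : ξ ∈ m)
    (hη : η ∈ lieAlgebraOf I (coadStabilizer I x)) :
    fderiv ℝ (fun u => Φ (d.map u) ξ) z (inducedVector I a η z) = 0 := by
  obtain ⟨c, h0, hcK, hc, rfl⟩ := hη
  refine (hΦ.hasDerivAt_curve hd hL ha hz h0 hc ξ).unique ?_
  have : (fun t => Φ (c t • d.map z) ξ) = fun _ => 0 := by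
    ext1 t
    rw [hΦ.map_smul]
    exact hy _ (hm.2 _ ((coadStabilizer I x).inv_mem (hcK t)) ξ hξ)
  rw [this]
  exact hasDerivAt_const _ _

theorem eventually_mem_naturalSlice_iff (hΦ : M.IsMomentMap I (⊤ : Subgroup G) σ Φ)
    {d : OrbifoldChart n X} (hd : d ∈ M.atlas)
    {O : Set (G × Eu n)} {a : G × Eu n → Eu n} (hL : IsActionLift I (⊤ : Subgroup G) d d O a)
    (ha : ∀ u, ((1 : G), u) ∈ O → a (1, u) = u) {z : Eu n} (hz : ((1 : G), z) ∈ O)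
    {x : LieDual I G} {m : Submodule ℝ (GroupLieAlgebra I G)} (hm : IsInvariantComplement I x m)
    (hy : ∀ ξ ∈ m, Φ (d.map z) ξ = 0) (hzx : Φ (d.map z) ∈ naturalSlice I x)
    {q : ℕ} {F : Eu n → Fin q → ℝ} (hF : ContDiffOn ℝ ∞ F d.domain)
    (hF0 : ∀ v, F v = 0 ↔ ∀ ξ ∈ m, Φ (d.map v) ξ = 0) {L : (Fin q → ℝ) →L[ℝ] E}
    (hbij : ∀ e', ∃ e, fderiv ℝ F z (inducedVector I a (L e) z) = e') :
    ∀ᶠ v in 𝓝 z, Φ (d.map v) ∈ naturalSlice I x ↔ F v = 0 := by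
  have hzd : z ∈ d.domain := hL.mem_domain _ hz
  obtain ⟨U, ⟨⟨V, hV, rfl⟩, hconn, hslice⟩, hzU⟩ := hzx
  have hcont : ContinuousAt (fun v => Φ (d.map v)) z :=
    (hΦ.continuousOn hd).continuousAt (d.isOpen_domain.mem_nhds hzd)
  have hVz : ∀ᶠ v in 𝓝 z, Φ (d.map v) ∈ V := hcont.eventually (hV.mem_nhds hzU.1)
  have hFz : F z = 0 := (hF0 z).2 hy
  have hFat : ContDiffAt ℝ ∞ F z := hF.contDiffAt (d.isOpen_domain.mem_nhds hzd)
  obtain ⟨κ, hκ0, hκ, hκv⟩ := exists_local_parametrization I (G := G) L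
  -- points near `z` can be moved into the annihilator of `m` by elements of the group
  have hmove : ∀ᶠ v in 𝓝 z, ∃ g : G, (g, v) ∈ O ∧ Φ (d.map (a (g, v))) ∈ V ∧
      ∀ ξ ∈ m, Φ (d.map (a (g, v))) ξ = 0 := by
    let A : (Fin q → ℝ) × Eu n → Eu n := fun p => a (κ p.1, p.2)
    have hA0 : A (0, z) = z := by
      change a (κ 0, z) = z
      rw [hκ0, ha z hz]
    have hz' : (κ ((0, z) : (Fin q → ℝ) × Eu n).1, ((0, z) : (Fin q → ℝ) × Eu n).2) ∈ O := by
      change (κ 0, z) ∈ O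
      rwa [hκ0]
    have hκ' : ContMDiffAt 𝓘(ℝ, (Fin q → ℝ) × Eu n) I ∞
        (fun p : (Fin q → ℝ) × Eu n => κ p.1) (0, z) :=
      ContMDiffAt.comp (((0, z) : (Fin q → ℝ) × Eu n)) (g := κ) hκ
        contDiff_fst.contMDiff.contMDiffAt
    have hA : ContDiffAt ℝ ∞ A (0, z) := by
      rw [← contMDiffAt_iff_contDiffAt]
      exact ContMDiffAt.comp (((0, z) : (Fin q → ℝ) × Eu n)) (g := a)
        (f := fun p : (Fin q → ℝ) × Eu n => (κ p.1, p.2))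
        (hL.contMDiffOn.contMDiffAt (hL.isOpen.mem_nhds hz'))
        (hκ'.prodMk contDiff_snd.contMDiff.contMDiffAt)
    have hFA : ContDiffAt ℝ ∞ (fun p => F (A p)) (0, z) := by
      refine ContDiffAt.comp _ ?_ hA
      rwa [hA0]
    let Θ : (Fin q → ℝ) × Eu n → Eu n × (Fin q → ℝ) := fun p => (p.2, F (A p))
    have hΘ : HasStrictFDerivAt Θ ((ContinuousLinearMap.snd ℝ (Fin q → ℝ) (Eu n)).prod
        (fderiv ℝ (fun p => F (A p)) (0, z))) (0, z) :=
      hasStrictFDerivAt_snd.prodMk (hFA.hasStrictFDerivAt (by simp))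
    have hpart : ∀ e : Fin q → ℝ, fderiv ℝ (fun p => F (A p)) (0, z) (e, 0) =
        fderiv ℝ F z (inducedVector I a (L e) z) := by
      intro e
      have h1 : HasDerivAt (fun t : ℝ => ((t • e, z) : (Fin q → ℝ) × Eu n)) (e, 0) 0 := by
        have := ((hasDerivAt_id (0 : ℝ)).smul_const e).prodMk (hasDerivAt_const (0 : ℝ) z)
        simpa using this
      have h2 : HasFDerivAt (fun p => F (A p)) (fderiv ℝ (fun p => F (A p)) (0, z))
          (((0 : ℝ) • e, z) : (Fin q → ℝ) × Eu n) := by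
        rw [zero_smul]
        exact (hFA.differentiableAt (by simp)).hasFDerivAt
      have h3 := h2.comp_hasDerivAt (0 : ℝ) h1
      have hcd : MDifferentiableAt 𝓘(ℝ, ℝ) I (fun t : ℝ => κ (t • e)) 0 := by
        have h4 : MDifferentiableAt 𝓘(ℝ, Fin q → ℝ) I κ ((0 : ℝ) • e) := by
          rw [zero_smul]
          exact hκ.mdifferentiableAt (by simp)
        have h5 : MDifferentiableAt 𝓘(ℝ, ℝ) 𝓘(ℝ, Fin q → ℝ) (fun t : ℝ => t • e) 0 :=
          (differentiableAt_id.smul_const e).mdifferentiableAt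
        exact MDifferentiableAt.comp (0 : ℝ) h4 h5
      have h6 := hL.hasDerivAt_curve hz (γ := fun t : ℝ => κ (t • e)) (by simp [hκ0]) hcd
      have h7 : HasFDerivAt F (fderiv ℝ F z) (a (κ ((0 : ℝ) • e), z)) := by
        rw [zero_smul, hκ0, ha z hz]
        exact (hFat.differentiableAt (by simp)).hasFDerivAt
      have h8 := h7.comp_hasDerivAt (0 : ℝ) h6
      rw [hκv] at h8
      exact h3.unique h8
    have hsurj : LinearMap.range ((ContinuousLinearMap.snd ℝ (Fin q → ℝ) (Eu n)).prod
        (fderiv ℝ (fun p => F (A p)) (0, z))).toLinearMap = ⊤ := by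
      rw [LinearMap.range_eq_top]
      rintro ⟨v, e'⟩
      obtain ⟨e, he⟩ := hbij (e' - fderiv ℝ (fun p => F (A p)) (0, z) (0, v))
      refine ⟨(e, v), Prod.ext rfl ?_⟩
      change fderiv ℝ (fun p => F (A p)) (0, z) (e, v) = e'
      have : ((e, v) : (Fin q → ℝ) × Eu n) = (e, 0) + (0, v) := by simp
      rw [this, map_add, hpart, he, sub_add_cancel]
    have hmap := hΘ.map_nhds_eq_of_surj hsurj
    have hΘ0 : Θ (0, z) = (z, 0) := by
      change (z, F (A (0, z))) = (z, 0)
      rw [hA0, hFz]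
    have hS : ∀ᶠ p in 𝓝 ((0, z) : (Fin q → ℝ) × Eu n),
        (κ p.1, p.2) ∈ O ∧ Φ (d.map (A p)) ∈ V := by
      refine Filter.Eventually.and ?_ ?_
      · exact (hκ'.continuousAt.prodMk continuousAt_snd).eventually (hL.isOpen.mem_nhds hz')
      · have hVA : ∀ᶠ v in 𝓝 (A (0, z)), Φ (d.map v) ∈ V := by
          rw [hA0]
          exact hVz
        exact hA.continuousAt.eventually hVA
    have himg := Filter.image_mem_map (m := Θ) hS
    rw [hmap, hΘ0] at himg
    have hi : ContinuousAt (fun v : Eu n => ((v, 0) : Eu n × (Fin q → ℝ))) z := by fun_prop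
    filter_upwards [hi.eventually himg] with v hv
    obtain ⟨⟨e, v'⟩, ⟨h1, h2⟩, h3⟩ := hv
    obtain rfl : v' = v := congrArg Prod.fst h3
    exact ⟨κ e, h1, h2, (hF0 _).1 (congrArg Prod.snd h3)⟩
  filter_upwards [hmove, hVz] with v ⟨g, hg, hgV, hgm⟩ hvV
  constructor
  · rintro ⟨U', ⟨⟨V', hV', rfl⟩, -, -⟩, hvU'⟩
    have hvU : Φ (d.map v) ∈ V ∩ isotropyDual I x := ⟨hvV, hvU'.2⟩
    have e : Φ (d.map (a (g, v))) = coad I g (Φ (d.map v)) := by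
      rw [← hΦ.map_smul]
      exact congrArg Φ (hL.map_eq ⟨g, trivial⟩ v hg)
    have hgU : coad I g (Φ (d.map v)) ∈ V ∩ isotropyDual I x := by
      rw [← e]
      exact ⟨hgV, m, hm, hgm⟩
    obtain ⟨h, hh, e'⟩ := hslice.orbit_inter _ hvU g hgU
    refine (hF0 v).2 fun ξ hξ => ?_
    have h1 : Φ (d.map v) = coad I h⁻¹ (Φ (d.map (a (g, v)))) := by
      rw [e, e', ← coad_mul, inv_mul_cancel, coad_one]
    rw [h1]
    exact hgm _ (hm.2 _ ((coadStabilizer I x).inv_mem ((coadStabilizer I x).inv_mem hh)) ξ hξ)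
  · intro hv0
    exact ⟨_, ⟨⟨V, hV, rfl⟩, hconn, hslice⟩, hvV, m, hm, (hF0 v).1 hv0⟩

theorem exists_localModel (hΦ : M.IsMomentMap I (⊤ : Subgroup G) σ Φ) (hσ : M.IsSymplectic σ)
    (hsmooth : M.IsSmoothAction I (⊤ : Subgroup G)) {d : OrbifoldChart n X} (hd : d ∈ M.atlas)
    {z : Eu n} (hzd : z ∈ d.domain) {x : LieDual I G} (hzx : Φ (d.map z) ∈ naturalSlice I x)
    {q : ℕ} (hq : Module.finrank ℝ (lieAlgebraOf I (coadStabilizer I x)) + q =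
      Module.finrank ℝ E) :
    ∃ (F : Eu n → Fin q → ℝ) (T : (Fin q → ℝ) →L[ℝ] Eu n),
      d.IsLocalModel (Φ ⁻¹' naturalSlice I x) z F T ∧
      ∀ e v, fderiv ℝ F z v = 0 → σ.form d z ![T e, v] = 0 := by
  have hfd : FiniteDimensional ℝ (GroupLieAlgebra I G) := inferInstanceAs (FiniteDimensional ℝ E)
  obtain ⟨O, a, hL, hz, ha⟩ := hsmooth.exists_lift_one hd hzd
  have hzx' := hzx
  obtain ⟨U, ⟨⟨V, hV, rfl⟩, hconn, hslice⟩, hzU⟩ := hzx'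
  obtain ⟨m, hm, hy⟩ := hzU.2
  have hqm : Module.finrank ℝ m = q := by
    have h1 := Submodule.finrank_add_eq_of_isCompl hm.1
    change _ = Module.finrank ℝ E at h1
    omega
  let b := Module.finBasisOfFinrankEq ℝ m hqm
  let L : (Fin q → ℝ) →L[ℝ] GroupLieAlgebra I G :=
    LinearMap.toContinuousLinearMap (m.subtype ∘ₗ b.equivFun.symm.toLinearMap)
  have hLm : ∀ e, L e ∈ m := fun e => (b.equivFun.symm e).2
  have hLs : ∀ ξ ∈ m, ∃ e, L e = ξ := fun ξ hξ =>
    ⟨b.equivFun ⟨ξ, hξ⟩, congrArg Subtype.val (b.equivFun.symm_apply_apply ⟨ξ, hξ⟩)⟩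
  have hLi : ∀ e, L e = 0 → e = 0 := fun e he => by
    have : b.equivFun.symm e = 0 := Subtype.ext he
    rwa [LinearEquiv.map_eq_zero_iff] at this
  have hLb : ∀ i, L (Pi.single i 1) = b i := fun i => by
    change ((b.equivFun.symm (Pi.single i 1) : m) : GroupLieAlgebra I G) = b i
    congr 1
    rw [LinearEquiv.symm_apply_eq]
    ext j
    simp [Pi.single_apply, eq_comm]
  let P : GroupLieAlgebra I G →L[ℝ] Eu n := mfderiv I 𝓘(ℝ, Eu n) (fun g => a (g, z)) 1
  let T : (Fin q → ℝ) →L[ℝ] Eu n := P.comp L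
  let F : Eu n → Fin q → ℝ := fun v i => Φ (d.map v) (b i)
  have hF : ContDiffOn ℝ ∞ F d.domain := contDiffOn_pi.2 fun i => hΦ.contDiffOn' hd _
  have hDF : ∀ v i, fderiv ℝ F z v i = fderiv ℝ (fun u => Φ (d.map u) (b i)) z v := by
    intro v i
    have h1 : HasFDerivAt F (ContinuousLinearMap.pi fun i =>
        fderiv ℝ (fun u => Φ (d.map u) (b i)) z) z :=
      hasFDerivAt_pi.2 fun i => hΦ.hasFDerivAt hd _ hzd
    rw [h1.fderiv]
    rfl
  have hcontr : ∀ ξ w, σ.form d z ![P ξ, w] = - fderiv ℝ (fun u => Φ (d.map u) ξ) z w :=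
    fun ξ w => hΦ.contraction hd hL ha hz ξ w
  have hsymp : ∀ e v, fderiv ℝ F z v = 0 → σ.form d z ![T e, v] = 0 := by
    intro e v hv
    obtain ⟨l, hl⟩ := (σ.form d z).exists_pairLeft v
    have h1 : l ∘ₗ T.toLinearMap = 0 := by
      refine LinearMap.pi_ext' fun i => LinearMap.ext_ring ?_
      change l (P (L (Pi.single i 1))) = 0
      rw [hLb, hl, hcontr, ← hDF, hv]
      simp
    rw [← hl]
    exact LinearMap.congr_fun h1 e
  have hinj : ∀ e, fderiv ℝ F z (T e) = 0 → e = 0 := by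
    intro e he
    refine hLi e ?_
    have h1 : ∀ η, fderiv ℝ (fun u => Φ (d.map u) η) z (inducedVector I a (L e) z) = 0 := by
      intro η
      obtain ⟨l, hl⟩ := (σ.form d z).exists_pairLeft (T e)
      obtain ⟨η₁, h₁, η₂, h₂, rfl⟩ := Submodule.mem_sup.1
        (show η ∈ lieAlgebraOf I (coadStabilizer I x) ⊔ m by rw [hm.1.sup_eq_top]; trivial)
      have h3 : l (P η₁) = 0 := by
        rw [hl, (σ.form d z).apply_pair_swap, neg_eq_zero]
        change σ.form d z ![P (L e), P η₁] = 0
        rw [hcontr, neg_eq_zero]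
        exact hΦ.fderiv_inducedVector_eq_zero hd hL ha hz hm hy (hLm e) h₁
      have h4 : l (P η₂) = 0 := by
        obtain ⟨e₂, rfl⟩ := hLs η₂ h₂
        rw [hl]
        exact hsymp e₂ (T e) he
      have h5 := hcontr (η₁ + η₂) (T e)
      rw [← hl, map_add, map_add, h3, h4, add_zero] at h5
      exact neg_eq_zero.1 h5.symm
    have h2 := hΦ.mem_lieAlgebraOf_coadStabilizer hd hL ha hz h1
    have h3 := lieAlgebraOf_mono (hslice.stabilizer_le _ hzU) h2
    exact (Submodule.disjoint_def.1 hm.1.disjoint) _ h3 (hLm e)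
  have hinj' : Function.Injective ((fderiv ℝ F z).comp T) := by
    rw [injective_iff_map_eq_zero]
    exact hinj
  have hsurj' : Function.Surjective ((fderiv ℝ F z).comp T) :=
    LinearMap.injective_iff_surjective (f := ((fderiv ℝ F z).comp T).toLinearMap).1 hinj'
  have hF0 : ∀ v, F v = 0 ↔ ∀ ξ ∈ m, Φ (d.map v) ξ = 0 := by
    intro v
    constructor
    · intro hv ξ hξ
      have h1 : (Φ (d.map v)).toLinearMap ∘ₗ m.subtype = 0 := b.ext fun i => congrFun hv i
      exact LinearMap.congr_fun h1 ⟨ξ, hξ⟩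
    · intro hv
      ext i
      exact hv _ (b i).2
  refine ⟨F, T, ⟨hF, ?_, ?_, ⟨hinj', hsurj'⟩, ?_⟩, hsymp⟩
  · intro γ hγ v hv
    ext i
    change Φ (d.map (γ v)) (b i) = Φ (d.map v) (b i)
    rw [d.map_apply hγ hv]
  · exact hΦ.eventually_mem_naturalSlice_iff hd hL ha hz hm hy hzx hF hF0 (L := L) hsurj'
  · intro γ hγ hγz e
    exact hΦ.apply_inducedVector hd hL ha hz hσ hγ hγz (L e)

end Orbifold.IsMomentMap

end CrossSection

/-! ### Actions on suborbifolds -/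

section SuborbifoldAction

variable {n k : ℕ} {X : Type*} [TopologicalSpace X] {Y : Type*} [TopologicalSpace Y]

/-- Two differentiable curves in a uniformizing chart with the same projection have the same
velocity up to the isotropy group. -/
theorem OrbifoldChart.exists_apply_deriv_eq (d : OrbifoldChart n X) {p p' : ℝ → Eu n} {t : ℝ}
    {v v' : Eu n} (hp : HasDerivAt p v t) (hp' : HasDerivAt p' v' t) (h0 : p t = p' t)
    (h : ∀ᶠ s in 𝓝 t, p s ∈ d.domain ∧ p' s ∈ d.domain ∧ d.map (p s) = d.map (p' s)) :
    ∃ γ ∈ d.group, γ (p t) = p t ∧ γ v = v' := by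
  have hfin : (d.group : Set (Eu n ≃L[ℝ] Eu n)).Finite := by
    have := d.finite_group
    exact Set.toFinite _
  by_contra! hne
  have key : ∀ γ ∈ (d.group : Set (Eu n ≃L[ℝ] Eu n)), ∀ᶠ s in 𝓝[≠] t, γ (p s) - p' s ≠ 0 := by
    intro γ hγ
    have hd : HasDerivAt (fun s => γ (p s) - p' s) (γ v - v') t :=
      (γ.hasFDerivAt.comp_hasDerivAt t hp).sub hp'
    by_cases hfix : γ (p t) = p t
    · exact hd.eventually_ne (sub_ne_zero.2 (hne γ hγ hfix))
    · refine (hd.continuousAt.eventually_ne ?_).filter_mono nhdsWithin_le_nhds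
      rw [← h0]
      exact sub_ne_zero.2 hfix
  have hall := (Filter.eventually_all_finite hfin).2 key
  obtain ⟨s, hs, h1, h2, h3⟩ := (hall.and (h.filter_mono nhdsWithin_le_nhds)).exists
  obtain ⟨γ, hγ, e⟩ := (d.map_eq_iff _ h1 _ h2).1 h3
  exact hs γ hγ (sub_eq_zero.2 e)

variable {E : Type*} [NormedAddCommGroup E] [NormedSpace ℝ E]
  {H : Type*} [TopologicalSpace H] {I : ModelWithCorners ℝ E H}
  {G : Type*} [TopologicalSpace G] [ChartedSpace H G] [Group G]
  [MulAction G X] {K : Subgroup G} [MulAction K Y] {M : Orbifold n X} {f : Y → X}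

namespace Orbifold

theorem suborbifold_isSmoothAction (hsmooth : M.IsSmoothAction I (⊤ : Subgroup G))
    (hf : Function.Injective f) (hfK : ∀ (g : K) (y : Y), f (g • y) = (g : G) • f y)
    (hc : ∀ y : Y, ∃ c ∈ M.adaptedCharts f k, ∃ u ∈ c.domain, c.map u = y) :
    (M.suborbifold f hf hc).IsSmoothAction I K := by
  rintro c ⟨d, hd, V, j, ρ, h⟩ c' ⟨d', hd', V', j', ρ', h'⟩ g u hu u' hu' e
  obtain ⟨O, a, hL, hO, ha⟩ := hsmooth d hd d' hd' ⟨g, trivial⟩ (j u) (h.subset (h.mapsTo hu))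
    (j' u') (h'.subset (h'.mapsTo hu')) (by
      rw [h'.map_eq _ hu', e, hfK, h.map_eq _ hu]
      rfl)
  have hO' : ((g : G), j u) ∈ O := hO
  have ha' : a ((g : G), j u) = j' u' := ha
  let b : G × Eu k → G × Eu n := fun q => (q.1, j q.2)
  have hS₁ : IsOpen (Prod.snd ⁻¹' c.domain : Set (G × Eu k)) :=
    c.isOpen_domain.preimage continuous_snd
  have hb : ContMDiffOn (I.prod 𝓘(ℝ, Eu k)) (I.prod 𝓘(ℝ, Eu n)) ∞ b (Prod.snd ⁻¹' c.domain) :=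
    contMDiffOn_fst.prodMk (h.contDiffOn.contMDiffOn.comp contMDiffOn_snd fun q hq => hq)
  have hS₂ : IsOpen (Prod.snd ⁻¹' c.domain ∩ b ⁻¹' O) :=
    hb.continuousOn.isOpen_inter_preimage hS₁ hL.isOpen
  have hab : ContMDiffOn (I.prod 𝓘(ℝ, Eu k)) 𝓘(ℝ, Eu n) ∞ (fun q => a (b q))
      (Prod.snd ⁻¹' c.domain ∩ b ⁻¹' O) :=
    hL.contMDiffOn.comp (hb.mono inter_subset_left) fun q hq => hq.2
  refine ⟨(Prod.snd ⁻¹' c.domain ∩ b ⁻¹' O) ∩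
    (fun q => a (b q)) ⁻¹' (V' ∩ ρ' ⁻¹' c'.domain), fun q => ρ' (a (b q)), ⟨?_, ?_, ?_, ?_, ?_⟩,
    ⟨⟨hu, hO'⟩, ?_⟩, ?_⟩
  · exact hab.continuousOn.isOpen_inter_preimage hS₂
      (h'.isOpen.inter (c'.isOpen_domain.preimage ρ'.continuous))
  · exact fun q hq => hq.1.1
  · exact fun q hq => hq.2.2
  · exact ρ'.contDiff.contMDiff.comp_contMDiffOn (hab.mono inter_subset_left)
  · rintro g' w ⟨⟨hw, hwO⟩, hwV, hwc⟩
    have hwO' : ((g' : G), j w) ∈ O := hwO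
    have e1 : d'.map (a ((g' : G), j w)) = f (g' • c.map w) := by
      rw [hfK, ← h.map_eq _ hw]
      exact hL.map_eq ⟨g', trivial⟩ _ hwO'
    obtain ⟨h1, h2⟩ := h'.right_inv _ hwV ⟨_, e1.symm⟩
    apply hf
    rw [← h'.map_eq _ h1, h2]
    exact e1
  · change a ((g : G), j u) ∈ V' ∩ ρ' ⁻¹' c'.domain
    rw [ha']
    refine ⟨h'.mapsTo hu', ?_⟩
    rw [mem_preimage, h'.left_inv _ hu']
    exact hu'
  · change ρ' (a ((g : G), j u)) = u'
    rw [ha', h'.left_inv _ hu']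

theorem Form.restrict_preservesForm {p : ℕ} {σ : M.Form p}
    (hsmooth : M.IsSmoothAction I (⊤ : Subgroup G))
    (hpres : M.PreservesForm I (⊤ : Subgroup G) σ)
    (hf : Function.Injective f) (hfK : ∀ (g : K) (y : Y), f (g • y) = (g : G) • f y)
    (hc : ∀ y : Y, ∃ c ∈ M.adaptedCharts f k, ∃ u ∈ c.domain, c.map u = y) :
    (M.suborbifold f hf hc).PreservesForm I K (σ.restrict hf hc) := by
  intro c hcM c' hcM' O a hL g u hu
  obtain ⟨d, hd, V, j, ρ, h, e⟩ := σ.exists_restrict_eq hf hc hcM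
  obtain ⟨d', hd', V', j', ρ', h', e'⟩ := σ.exists_restrict_eq hf hc hcM'
  have hmem : ∀ w, ((g : G), w) ∈ O → w ∈ c.domain := fun w hw => hL.mem_domain _ hw
  have hmem' : ∀ w, ((g : G), w) ∈ O → a (g, w) ∈ c'.domain := fun w hw => hL.apply_mem _ hw
  have hcov : ∀ w, ((g : G), w) ∈ O → d'.map (j' (a (g, w))) = (g : G) • d.map (j w) := by
    intro w hw
    rw [h'.map_eq _ (hmem' w hw), hL.map_eq g w hw, hfK, h.map_eq _ (hmem w hw)]
  have hju : j u ∈ d.domain := h.subset (h.mapsTo (hmem u hu))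
  obtain ⟨O', a', hL', hO', -⟩ := hsmooth d hd d' hd' ⟨g, trivial⟩ (j u) hju (j' (a (g, u)))
    (h'.subset (h'.mapsTo (hmem' u hu))) (hcov u hu)
  have hO'' : ((g : G), j u) ∈ O' := hO'
  have hjc : ContDiffOn ℝ ∞ j {w | ((g : G), w) ∈ O} := h.contDiffOn.mono hmem
  have hWo : IsOpen ({w | ((g : G), w) ∈ O} ∩ j ⁻¹' {z | ((g : G), z) ∈ O'}) :=
    hjc.continuousOn.isOpen_inter_preimage (hL.isOpen_slice g) (hL'.isOpen_slice g)
  have hu' : u ∈ {w | ((g : G), w) ∈ O} ∩ j ⁻¹' {z | ((g : G), z) ∈ O'} := ⟨hu, hO''⟩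
  have h1 := hpres d hd d' hd' O' a' hL' ⟨g, trivial⟩ (j u) hO'
  have h2 := σ.pullback_eq_of_map_eq hd' hWo (f := fun w => a' ((g : G), j w))
    (g := fun w => j' (a ((g : G), w)))
    ((hL'.contDiffOn_slice g).comp (hjc.mono inter_subset_left) fun w hw => hw.2)
    (h'.contDiffOn.comp ((hL.contDiffOn_slice g).mono inter_subset_left)
      fun w hw => hmem' w hw.1)
    (fun w hw => hL'.apply_mem _ hw.2) (fun w hw => h'.subset (h'.mapsTo (hmem' w hw.1)))
    (fun w hw => by
      rw [hcov w hw.1]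
      exact hL'.map_eq ⟨g, trivial⟩ (j w) hw.2) hu'
  have hc1 : fderiv ℝ (fun w => a' ((g : G), j w)) u =
      (fderiv ℝ (fun z => a' ((g : G), z)) (j u)).comp (fderiv ℝ j u) :=
    fderiv_comp (g := fun z => a' ((g : G), z)) u
      (((hL'.contDiffOn_slice g).contDiffAt ((hL'.isOpen_slice g).mem_nhds hO'')).differentiableAt
        (by simp))
      ((h.contDiffOn.contDiffAt (c.isOpen_domain.mem_nhds (hmem u hu))).differentiableAt (by simp))
  have hc2 : fderiv ℝ (fun w => j' (a ((g : G), w))) u =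
      (fderiv ℝ j' (a ((g : G), u))).comp (fderiv ℝ (fun w => a ((g : G), w)) u) :=
    fderiv_comp (f := fun w => a ((g : G), w)) u
      ((h'.contDiffOn.contDiffAt (c'.isOpen_domain.mem_nhds (hmem' u hu))).differentiableAt
        (by simp))
      (((hL.contDiffOn_slice g).contDiffAt ((hL.isOpen_slice g).mem_nhds hu)).differentiableAt
        (by simp))
  rw [hc1, hc2] at h2
  rw [e, e']
  dsimp only
  rw [h1]
  exact h2

variable [LieGroup I ∞ G] [FiniteDimensional ℝ E] [I.Boundaryless]

theorem IsMomentMap.restrict {σ : M.Form 2} {Φ : X → LieDual I G}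
    (hΦ : M.IsMomentMap I (⊤ : Subgroup G) σ Φ) (hσ : M.IsSymplectic σ)
    (hsmooth : M.IsSmoothAction I (⊤ : Subgroup G))
    (hf : Function.Injective f) (hfK : ∀ (g : K) (y : Y), f (g • y) = (g : G) • f y)
    (hc : ∀ y : Y, ∃ c ∈ M.adaptedCharts f k, ∃ u ∈ c.domain, c.map u = y) :
    (M.suborbifold f hf hc).IsMomentMap I K (σ.restrict hf hc) (fun y => Φ (f y)) where
  contDiffOn := by
    rintro c ⟨d, hd, V, j, ρ, h⟩ ξ -
    refine ((hΦ.contDiffOn' hd ξ).comp h.contDiffOn fun w hw => h.subset (h.mapsTo hw)).congr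
      fun w hw => ?_
    rw [← h.map_eq _ hw]
    rfl
  equivariant := by
    intro g y ξ _
    rw [hfK, hΦ.map_smul]
  contraction_eq := by
    rintro c hcM O a hL ha u hu ξ ⟨γ, h0, hγK, hγd, rfl⟩ w
    obtain ⟨d, hd, V, j, ρ, h, e⟩ := σ.exists_restrict_eq hf hc hcM
    have huc : u ∈ c.domain := hL.mem_domain _ hu
    have hju : j u ∈ d.domain := h.subset (h.mapsTo huc)
    have hjd : HasFDerivAt j (fderiv ℝ j u) u :=
      ((h.contDiffOn.contDiffAt (c.isOpen_domain.mem_nhds huc)).differentiableAt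
        (by simp)).hasFDerivAt
    obtain ⟨O', a', hL', hz, ha'⟩ := hsmooth.exists_lift_one hd hju
    have hvec : fderiv ℝ j u (inducedVector I a (velocity I γ : E) u) =
        inducedVector I a' (velocity I γ : E) (j u) := by
      have h1 := hL.hasDerivAt_curve hu h0 hγd
      have h1' : HasFDerivAt j (fderiv ℝ j u) (a (γ 0, u)) := by
        rwa [h0, ha u hu]
      have h2 := h1'.comp_hasDerivAt (0 : ℝ) h1
      have h3 := hL'.hasDerivAt_curve hz h0 hγd
      have e0 : a' (γ 0, j u) = j u := by rw [h0, ha' _ hz]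
      obtain ⟨g, hg, hgz, hgv⟩ := d.exists_apply_deriv_eq h3 h2 (by
          change a' (γ 0, j u) = j (a (γ 0, u))
          rw [e0, h0, ha u hu]) (by
        filter_upwards [hL.eventually_mem hu h0 hγd, hL'.eventually_mem hz h0 hγd] with t h4 h5
        have hat : a (γ t, u) ∈ c.domain := hL.apply_mem _ h4
        refine ⟨hL'.apply_mem _ h5, h.subset (h.mapsTo hat), ?_⟩
        have e1 : c.map (a (γ t, u)) = (⟨γ t, hγK t⟩ : K) • c.map u :=
          hL.map_eq ⟨γ t, hγK t⟩ u h4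
        have e2 : d.map (a' (γ t, j u)) = γ t • d.map (j u) :=
          hL'.map_eq ⟨γ t, trivial⟩ (j u) h5
        change d.map (a' (γ t, j u)) = d.map (j (a (γ t, u)))
        rw [e2, h.map_eq _ hat, e1, hfK, h.map_eq _ huc])
      rw [e0] at hgz
      rw [← hgv]
      exact hΦ.apply_inducedVector hd hL' ha' hz hσ hg hgz _
    have h1 : (σ.restrict hf hc).form c u ![inducedVector I a (velocity I γ : E) u, w] =
        σ.form d (j u) ![inducedVector I a' (velocity I γ : E) (j u), fderiv ℝ j u w] := by
      rw [e, ← hvec]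
      change σ.form d (j u) (fderiv ℝ j u ∘ ![inducedVector I a (velocity I γ : E) u, w]) = _
      congr 1
      ext i : 1
      fin_cases i <;> rfl
    have h2 : fderiv ℝ (fun u' => Φ (f (c.map u')) (velocity I γ : E)) u =
        (fderiv ℝ (fun z => Φ (d.map z) (velocity I γ : E)) (j u)).comp (fderiv ℝ j u) := by
      refine HasFDerivAt.fderiv ?_
      refine ((hΦ.hasFDerivAt hd (velocity I γ : E) hju).comp u hjd).congr_of_eventuallyEq ?_
      refine Filter.eventuallyEq_of_mem (c.isOpen_domain.mem_nhds huc) fun w hw => ?_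
      change Φ (f (c.map w)) _ = Φ (d.map (j w)) _
      rw [h.map_eq _ hw]
    refine h1.trans ((hΦ.contraction hd hL' ha' hz _ _).trans ?_)
    rw [h2]
    rfl

end Orbifold

end SuborbifoldAction

end

theorem mainTheorem6
    {E : Type*} [NormedAddCommGroup E] [NormedSpace ℝ E] [FiniteDimensional ℝ E]
    {H : Type*} [TopologicalSpace H] (I : ModelWithCorners ℝ E H) [I.Boundaryless]
    {G : Type*} [TopologicalSpace G] [ChartedSpace H G] [Group G] [LieGroup I ∞ G]
    [T2Space G] [CompactSpace G]
    {X : Type*} [TopologicalSpace X] [T2Space X] [MulAction G X]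
    {n : ℕ} (M : Orbifold n X) (σ : M.Form 2) (hσ : M.IsSymplectic σ)
    (hsmooth : M.IsSmoothAction I (⊤ : Subgroup G))
    (hpres : M.PreservesForm I (⊤ : Subgroup G) σ)
    (Φ : X → LieDual I G) (hΦ : M.IsMomentMap I (⊤ : Subgroup G) σ Φ)
    (x : LieDual I G) :
    ∃ R : SubMulAction (coadStabilizer I x) X,
      (R : Set X) = Φ ⁻¹' naturalSlice I x ∧
      ∃ (k : ℕ) (N : Orbifold k R) (τ : N.Form 2),
        N.IsEmbedding M (fun r : R => (r : X)) ∧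
        τ.IsPullback (fun r : R => (r : X)) σ ∧
        N.IsSymplectic τ ∧
        N.IsSmoothAction I (coadStabilizer I x) ∧
        N.PreservesForm I (coadStabilizer I x) τ ∧
        N.IsMomentMap I (coadStabilizer I x) τ (fun r : R => Φ r) := by
  let R : SubMulAction (coadStabilizer I x) X :=
    { carrier := Φ ⁻¹' naturalSlice I x
      smul_mem' := by
        rintro g p ⟨U, hU, hp⟩
        refine ⟨U, hU, ?_⟩
        have : Φ (g • p) = coad I (g : G) (Φ p) := hΦ.map_smul (g : G) p
        rw [this]
        exact hU.2.2.invariant g g.2 _ hp }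
  have hrange : range (fun r : R => (r : X)) = Φ ⁻¹' naturalSlice I x := Subtype.range_coe
  have hf : Topology.IsEmbedding (fun r : R => (r : X)) := Topology.IsEmbedding.subtypeVal
  have hfK : ∀ (g : coadStabilizer I x) (r : R), ((g • r : R) : X) = (g : G) • (r : X) :=
    fun _ _ => rfl
  let q := Module.finrank ℝ E - Module.finrank ℝ (lieAlgebraOf I (coadStabilizer I x))
  have hq : Module.finrank ℝ (lieAlgebraOf I (coadStabilizer I x)) + q = Module.finrank ℝ E := by
    have : FiniteDimensional ℝ (GroupLieAlgebra I G) := inferInstanceAs (FiniteDimensional ℝ E)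
    exact Nat.add_sub_cancel' (Submodule.finrank_le (lieAlgebraOf I (coadStabilizer I x)))
  have hmodel : ∀ d ∈ M.atlas, ∀ z ∈ d.domain, d.map z ∈ range (fun r : R => (r : X)) →
      ∃ (F : Eu n → Fin q → ℝ) (T : (Fin q → ℝ) →L[ℝ] Eu n),
        d.IsLocalModel (range fun r : R => (r : X)) z F T ∧
        ∀ e v, fderiv ℝ F z v = 0 → σ.form d z ![T e, v] = 0 := by
    rw [hrange]
    exact fun d hd z hz hzR => hΦ.exists_localModel hσ hsmooth hd hz hzR hq
  have hn : Nonempty R → n - q + q = n := by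
    rintro ⟨r⟩
    obtain ⟨d, hd, z, hz, e⟩ := M.cover (r : X)
    obtain ⟨F, T, hF, -⟩ := hmodel d hd z hz ⟨r, e.symm⟩
    have hT : Function.Injective T := by
      have := hF.bijective.1
      rw [ContinuousLinearMap.coe_comp] at this
      exact this.of_comp
    have h1 := LinearMap.finrank_le_finrank_of_injective (f := T.toLinearMap) hT
    rw [Module.finrank_fintype_fun_eq_card, Fintype.card_fin, finrank_euclideanSpace,
      Fintype.card_fin] at h1
    exact Nat.sub_add_cancel h1
  have hc : ∀ r : R, ∃ c ∈ M.adaptedCharts (fun r : R => (r : X)) (n - q),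
      ∃ u ∈ c.domain, c.map u = r := by
    intro r
    obtain ⟨d, hd, z, hz, e⟩ := M.cover (r : X)
    obtain ⟨F, T, hF, -⟩ := hmodel d hd z hz ⟨r, e.symm⟩
    obtain ⟨c, V, j, ρ, h, hu⟩ := hF.exists_adapted hf (hn ⟨r⟩) hz e
    exact ⟨c, ⟨d, hd, V, j, ρ, h⟩, hu⟩
  exact ⟨R, rfl, n - q, M.suborbifold _ hf.injective hc, σ.restrict hf.injective hc,
    Orbifold.suborbifold_isEmbedding hf hc, σ.restrict_isPullback hf.injective hc,
    Orbifold.Form.restrict_isSymplectic hf.injective hc hσ hn hmodel,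
    Orbifold.suborbifold_isSmoothAction hsmooth hf.injective hfK hc,
    Orbifold.Form.restrict_preservesForm hsmooth hpres hf.injective hfK hc,
    hΦ.restrict hσ hsmooth hf.injective hfK hc⟩
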